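/- Let $\Omega$ be a complex manifold of dimension $n$, let $D_1,\dots,D_m$ ($m\ge 1$) be distinct, smooth, connected hypersurfaces in $\Omega$ such that $Z=\bigcap_i D_i$ is nonempty and connected and the $D_i$ meet transversely along $Z$; thus $Z$ is a connected submanifold of codimension $m$. Let $U\subseteq\Omega$ be open and let $\varphi\colon U\to\mathbf{R}\cup\{-\infty\}$ be plurisubharmonic (in particular $\varphi\not\equiv-\infty$ on every connected component of $U$). Given $z\in Z\cap U$, local analytic coordinates $u=(u_1,\dots,u_n)$ at $z$ with $u(z)=0$ are called *adapted* if $D_i=\{u_i=0\}$ near $z$ for $1\le i\le m$. For $t\in\mathbf{R}^n$ put $D_u(t)=\bigcap_{i=1}^n\{|u_i|\le e^{t_i}\}$. Call $\varepsilon>0$ *admissible* for $u$ if the range of $u$ contains $\{w\in\mathbf{C}^n: |w_i|\le\varepsilon \text{ for all } i\}$ and the polydisc $D_u(\log\varepsilon,\dots,\log\varepsilon)$ is contained in $U$. For $t_i\le\log\varepsilon$ set $H(t)=\sup_{D_u(t)}\varphi$, and for $\alpha\in\mathbf{R}^n_{\ge0}$ set $$h(\alpha)=h_{\varphi,z,u,\varepsilon}(\alpha)=\lim_{s\to-\infty}\frac{H(\log\varepsilon+s\alpha)}{s}.$$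 Then for all adapted coordinates and all admissible $\varepsilon$, $H$ is finite-valued, the limit exists in $\mathbf{R}$, and: (i) $h$ is nonnegative, continuous, concave, $1$-homogeneous and increasing (in the weak sense) in each argument on $\mathbf{R}^n_{\ge0}$; (ii) $h$ does not depend on the choice of admissible $\varepsilon$. If, further, $\alpha_i=0$ for $i>m$, then (iii) $h(\alpha)$ does not depend on the choice of adapted local coordinates $u$ at $z$; (iv) $h(\alpha)$ does not depend on the choice of the point $z$ within a connected subset $C$ of $Z\cap U$ (for example $C=Z$ if $\varphi$ is defined in a neighborhood of $Z$). Consequently, if $C\subseteq Z\cap U$ is nonempty and connected, and if $\alpha_i>0$ for $i\le m$ and $\alpha_i=0$ for $i>m$, the Kiselman number is well defined: there is exactly one real number $\tau$ such that $\tau\ge0$ and $h_{\varphi,z,u,\varepsilon}(\alpha)=\tau$ for all $z\in C$, all adapted coordinates $u$ at $z$ and all admissible $\varepsilon$. -/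

import Mathlib

open Set Filter Topology MeasureTheory
open scoped Manifold ContDiff

noncomputable section

namespace Kiselman

/-- The mean value `(2π)⁻¹ ∫₀^{2π} v (c + r e^{iθ}) dθ` of an extended-real function over a circle,
as the integral of the positive part minus the integral of the negative part. For an upper
semicontinuous `v < ∞` the first of these is finite, so the value lies in `[-∞, ∞)`. -/
def circleMean (v : ℂ → EReal) (c : ℂ) (r : ℝ) : EReal :=
  (((ENNReal.ofReal (2 * Real.pi))⁻¹ *
      ∫⁻ θ in Ioc (0 : ℝ) (2 * Real.pi), (v (circleMap c r θ)).toENNReal : ENNReal) : EReal) -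
  (((ENNReal.ofReal (2 * Real.pi))⁻¹ *
      ∫⁻ θ in Ioc (0 : ℝ) (2 * Real.pi), (-v (circleMap c r θ)).toENNReal : ENNReal) : EReal)

/-- `v : 𝔻 → ℝ ∪ {-∞}` is subharmonic on the open unit disc `𝔻 = ball 0 1`: not identically `-∞`,
upper semicontinuous, and satisfying the sub-mean value inequality on every closed disc in `𝔻`. -/
structure IsSubharmonicOnDisc (v : ℂ → EReal) : Prop where
  ne_top : ∀ x ∈ Metric.ball (0 : ℂ) 1, v x ≠ ⊤
  ne_bot : ∃ x ∈ Metric.ball (0 : ℂ) 1, v x ≠ ⊥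
  usc : UpperSemicontinuousOn v (Metric.ball (0 : ℂ) 1)
  le_mean : ∀ (c : ℂ) (r : ℝ), 0 < r → Metric.closedBall c r ⊆ Metric.ball (0 : ℂ) 1 →
    v c ≤ circleMean v c r

section Manifold

variable {n : ℕ} {Ω : Type*} [TopologicalSpace Ω] [ChartedSpace (Fin n → ℂ) Ω]

/-- `φ` is plurisubharmonic on the open subset `U` of the `n`-dimensional complex manifold `Ω`
(the values of `φ` off `U` play no role). -/
structure IsPsh (φ : Ω → EReal) (U : Set Ω) : Prop where
  ne_top : ∀ x ∈ U, φ x ≠ ⊤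
  ne_bot : ∀ x ∈ U, ∃ y ∈ connectedComponentIn U x, φ y ≠ ⊥
  usc : UpperSemicontinuousOn φ U
  disc : ∀ τ : ℂ → Ω,
    MDifferentiableOn 𝓘(ℂ, ℂ) 𝓘(ℂ, Fin n → ℂ) τ (Metric.ball (0 : ℂ) 1) →
    MapsTo τ (Metric.ball (0 : ℂ) 1) U →
    IsSubharmonicOnDisc (φ ∘ τ) ∨ ∀ ζ ∈ Metric.ball (0 : ℂ) 1, φ (τ ζ) = ⊥

/-- `f` is a local defining function of the smooth hypersurface `D` at `x`: it is holomorphic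
(complex analytic) near `x`, has nonzero differential at `x`, and `D = {f = 0}` near `x`. -/
structure IsLocalDefiningFunction (D : Set Ω) (x : Ω) (f : Ω → ℂ) : Prop where
  holo : ContMDiffAt 𝓘(ℂ, Fin n → ℂ) 𝓘(ℂ, ℂ) ω f x
  zero : ∀ᶠ y in 𝓝 x, (y ∈ D ↔ f y = 0)
  deriv_ne : mfderiv 𝓘(ℂ, Fin n → ℂ) 𝓘(ℂ, ℂ) f x ≠ 0

variable (n) in
/-- A smooth complex hypersurface: a subset which at each of its points has a local defining
function. (Closedness in `Ω` is not imposed.) -/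
def IsSmoothHypersurface (D : Set Ω) : Prop :=
  ∀ x ∈ D, ∃ f : Ω → ℂ, IsLocalDefiningFunction (n := n) D x f

/-- `D₁, …, D_m` are distinct, smooth, connected hypersurfaces in `Ω`, and `Z = ⋂ Dᵢ` is connected
and the `Dᵢ` meet transversely along `Z`: at each point of `Z` the differentials of local
defining functions of `D₁, …, D_m` are linearly independent.
(Hence `Z` is a submanifold of codimension `m`.) -/
structure IsTransverseIntersection {m : ℕ} (Z : Set Ω) (D : Fin m → Set Ω) : Prop where
  distinct : Function.Injective D
  smooth : ∀ i, IsSmoothHypersurface n (D i)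
  connected : ∀ i, IsConnected (D i)
  eq_iInter : Z = ⋂ i, D i
  connected_inter : IsConnected Z
  transverse : ∀ z ∈ Z, ∀ f : Fin m → Ω → ℂ,
    (∀ i, IsLocalDefiningFunction (n := n) (D i) z (f i)) →
    LinearIndependent ℂ (fun i : Fin m =>
      (show (Fin n → ℂ) →L[ℂ] ℂ from mfderiv 𝓘(ℂ, Fin n → ℂ) 𝓘(ℂ, ℂ) (f i) z))

/-- `u = (u₁, …, u_n)` is a system of local analytic coordinates centred at `z` such that
`Dᵢ = {uᵢ = 0}` near `z` for `1 ≤ i ≤ m`. -/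
structure IsAdaptedCoord {m : ℕ} (hmn : m ≤ n) (D : Fin m → Set Ω) (z : Ω)
    (u : OpenPartialHomeomorph Ω (Fin n → ℂ)) : Prop where
  mem_atlas : u ∈ IsManifold.maximalAtlas 𝓘(ℂ, Fin n → ℂ) ω Ω
  mem_source : z ∈ u.source
  map_eq_zero : u z = 0
  adapted : ∀ i : Fin m, ∀ᶠ y in 𝓝 z, (y ∈ D i ↔ u y (Fin.castLE hmn i) = 0)

/-- The closed polydisc `D_u(t) = ⋂ᵢ {|uᵢ| ≤ e^{tᵢ}}` in the domain of the coordinates `u`. -/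
def polydisc (u : OpenPartialHomeomorph Ω (Fin n → ℂ)) (t : Fin n → ℝ) : Set Ω :=
  {x | x ∈ u.source ∧ ∀ i, ‖u x i‖ ≤ Real.exp (t i)}

/-- `ε > 0` is so small that the full polydisc of radius `ε` lies in the range of the coordinates
and `D_u(log ε)` is contained in the open set `U` on which the psh function is defined. -/
structure IsAdmissible (U : Set Ω) (u : OpenPartialHomeomorph Ω (Fin n → ℂ)) (ε : ℝ) : Prop where
  pos : 0 < ε
  subset_target : {w : Fin n → ℂ | ∀ i, ‖w i‖ ≤ ε} ⊆ u.target
  subset_domain : polydisc u (fun _ => Real.log ε) ⊆ U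

/-- `H(t) = sup_{D_u(t)} φ`. -/
def supPolydisc (φ : Ω → EReal) (u : OpenPartialHomeomorph Ω (Fin n → ℂ)) (t : Fin n → ℝ) :
    EReal :=
  ⨆ x ∈ polydisc u t, φ x

/-- The quotient `H(log ε + s α) / s`. -/
def quotient (φ : Ω → EReal) (u : OpenPartialHomeomorph Ω (Fin n → ℂ)) (ε : ℝ)
    (α : Fin n → ℝ) (s : ℝ) : ℝ :=
  (supPolydisc φ u (fun i => Real.log ε + s * α i)).toReal / s

/-- `h(α) = lim_{s → -∞} H(log ε + s α) / s`. -/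
def h (φ : Ω → EReal) (u : OpenPartialHomeomorph Ω (Fin n → ℂ)) (ε : ℝ) (α : Fin n → ℝ) : ℝ :=
  limUnder atBot (quotient φ u ε α)

end Manifold

end Kiselman

end

noncomputable section

namespace Kiselman

/-! ### Recession functions of increasing convex functions on an orthant. -/

section ConvexAnalysis

/-! In logarithmic polyradii, `H` is increasing and convex: a several-variable form of Hadamard's
three circles theorem (`IsPshOn.boxSup_convexOn`). It is finite because a plurisubharmonic function
is not identically -∞ on any nonempty open set (`IsPsh.exists_ne_bot`). Hence `h` is the recession
function of a convex function, and (i) and (ii) are statements about such functions: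
`recession_spec`, `recession_continuousOn`, `recession_eq`.

For (iii), the transition map F between two adapted systems is Lipschitz near 0, and its i-th
component vanishes on {w_i = 0} for i ≤ m, so |F_i(w)| ≤ K |w_i|. The components with i > m only
need to stay bounded, because α_i = 0 there. A small polydisc of one system thus lies in the
corresponding polydisc of the other for every s ≤ 0 (`IsAdaptedCoord.exists_polydisc_subset`).
Shrinking the radius costs nothing by (ii), and the roles of the two systems may be exchanged.

For (iv), translating coordinates adapted at z by u(z') gives coordinates adapted at a nearby z' in
Z, and the two families of polydiscs are nested in both directions up to a change of radius
(`IsAdaptedCoord.eventually_h_eq`). So `h(α)` is locally constant along Z ∩ U, hence constant on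
connected subsets. Adapted coordinates exist at every point of Z by the inverse function theorem
(`IsTransverseIntersection.exists_isAdaptedCoord`); this makes the chaining legitimate and the
Kiselman number unique. -/

theorem exists_tendsto_div_atBot {k : ℝ → ℝ} (hk : ConvexOn ℝ (Iic 0) k)
    (hm : MonotoneOn k (Iic 0)) :
    ∃ L, 0 ≤ L ∧ (∀ s < 0, L ≤ (k s - k 0) / s) ∧
      Tendsto (fun s => k s / s) atBot (𝓝 L) := by
  -- The slopes of the secants ending at 0 are nonnegative and increasing in s, so they tend to
  -- their infimum at -∞; the term `k 0 / s` disappears in the limit.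
  set g : ℝ → ℝ := fun s => (k s - k 0) / s with hg
  have gmono : ∀ x < 0, ∀ y < 0, x ≤ y → g x ≤ g y := by
    intro x hx y hy hxy
    have := hk.secant_mono (a := 0) (x := x) (y := y) (by simp) (by simpa using hx.le)
      (by simpa using hy.le) hx.ne hy.ne hxy
    simpa [hg] using this
  have gnonneg : ∀ x < 0, 0 ≤ g x := by
    intro x hx
    exact div_nonneg_of_nonpos
      (sub_nonpos.2 (hm (by simpa using hx.le) (by simp) hx.le)) hx.le
  -- Truncating at -1 makes the slope monotone on all of ℝ without changing it near -∞.
  have neg1 : ∀ s : ℝ, min s (-1) < 0 := fun s => lt_of_le_of_lt (min_le_right _ _) (by norm_num)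
  have hmono : Monotone (fun s => g (min s (-1))) := fun x y hxy =>
    gmono _ (neg1 x) _ (neg1 y) (min_le_min_right _ hxy)
  have hbdd : BddBelow (range (fun s => g (min s (-1)))) :=
    ⟨0, by rintro _ ⟨s, rfl⟩; exact gnonneg _ (neg1 s)⟩
  refine ⟨⨅ s, g (min s (-1)), le_ciInf fun s => gnonneg _ (neg1 s), ?_, ?_⟩
  · intro s hs
    exact (ciInf_le hbdd s).trans (gmono _ (neg1 s) _ hs (min_le_left _ _))
  · have h1 := tendsto_atBot_ciInf hmono hbdd
    have h2 : Tendsto (fun s : ℝ => k 0 * s⁻¹) atBot (𝓝 0) := by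
      simpa using tendsto_inv_atBot_zero.const_mul (k 0)
    have h3 := h1.add h2
    rw [add_zero] at h3
    refine h3.congr' ?_
    filter_upwards [eventually_le_atBot (-1 : ℝ)] with s hs
    rw [min_eq_left hs, hg]
    field_simp
    ring

variable {n : ℕ} {K : (Fin n → ℝ) → ℝ} {T : ℝ}

/-- The quotient whose limit at `-∞` is the recession function of `K`, with base point on the
diagonal. -/
def recessionQuotient (K : (Fin n → ℝ) → ℝ) (c : ℝ) (α : Fin n → ℝ) (s : ℝ) : ℝ :=
  K (fun i => c + s * α i) / s

/-- The recession function `α ↦ lim_{s → -∞} K(c + s α) / s`. -/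
def recession (K : (Fin n → ℝ) → ℝ) (c : ℝ) (α : Fin n → ℝ) : ℝ :=
  limUnder atBot (recessionQuotient K c α)

theorem ray_mem {c : ℝ} (hc : c ≤ T) {α : Fin n → ℝ} (hα : 0 ≤ α) {s : ℝ} (hs : s ≤ 0) :
    (fun i => c + s * α i) ∈ Iic (fun _ : Fin n => T) := by
  intro i
  have := mul_nonpos_of_nonpos_of_nonneg hs (hα i)
  simp only at this ⊢
  linarith [this]

theorem ray_convexOn (hK : ConvexOn ℝ (Iic fun _ => T) K) {c : ℝ} (hc : c ≤ T)
    {α : Fin n → ℝ} (hα : 0 ≤ α) :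
    ConvexOn ℝ (Iic 0) (fun s : ℝ => K (fun i => c + s * α i)) := by
  refine ⟨convex_Iic _, fun x hx y hy a b ha hb hab => ?_⟩
  have := hK.2 (ray_mem hc hα hx) (ray_mem hc hα hy) ha hb hab
  convert this using 2
  ext i
  simp only [smul_eq_mul, Pi.add_apply, Pi.smul_apply]
  linear_combination (-c) * hab

theorem ray_monotoneOn (hM : MonotoneOn K (Iic fun _ => T)) {c : ℝ} (hc : c ≤ T)
    {α : Fin n → ℝ} (hα : 0 ≤ α) :
    MonotoneOn (fun s : ℝ => K (fun i => c + s * α i)) (Iic 0) := by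
  intro x hx y hy hxy
  refine hM (ray_mem hc hα hx) (ray_mem hc hα hy) fun i => ?_
  have := mul_le_mul_of_nonneg_right hxy (hα i)
  simp only at this ⊢
  linarith [this]

theorem recession_spec (hK : ConvexOn ℝ (Iic fun _ => T) K) (hM : MonotoneOn K (Iic fun _ => T))
    {c : ℝ} (hc : c ≤ T) {α : Fin n → ℝ} (hα : 0 ≤ α) :
    0 ≤ recession K c α ∧
    (∀ s < 0, recession K c α ≤ (K (fun i => c + s * α i) - K (fun _ => c)) / s) ∧
    Tendsto (recessionQuotient K c α) atBot (𝓝 (recession K c α)) := by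
  obtain ⟨L, h0, h1, h2⟩ :=
    exists_tendsto_div_atBot (ray_convexOn hK hc hα) (ray_monotoneOn hM hc hα)
  have : recession K c α = L := Tendsto.limUnder_eq h2
  rw [this]
  exact ⟨h0, by simpa using h1, h2⟩

/-- The inequality is reversed because the quotients are taken with s negative. -/
theorem recession_le_of_le {K₁ K₂ : (Fin n → ℝ) → ℝ} {T₁ T₂ c₁ c₂ : ℝ}
    (hK₁ : ConvexOn ℝ (Iic fun _ => T₁) K₁) (hM₁ : MonotoneOn K₁ (Iic fun _ => T₁))
    (hK₂ : ConvexOn ℝ (Iic fun _ => T₂) K₂) (hM₂ : MonotoneOn K₂ (Iic fun _ => T₂))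
    (hc₁ : c₁ ≤ T₁) (hc₂ : c₂ ≤ T₂) {α : Fin n → ℝ} (hα : 0 ≤ α)
    (hle : ∀ s ≤ 0, K₁ (fun i => c₁ + s * α i) ≤ K₂ (fun i => c₂ + s * α i)) :
    recession K₂ c₂ α ≤ recession K₁ c₁ α := by
  refine le_of_tendsto_of_tendsto (recession_spec hK₂ hM₂ hc₂ hα).2.2
    (recession_spec hK₁ hM₁ hc₁ hα).2.2 ?_
  filter_upwards [eventually_lt_atBot (0 : ℝ)] with s hs
  exact (div_le_div_right_of_neg hs).2 (hle s hs.le)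

theorem recession_smul (hK : ConvexOn ℝ (Iic fun _ => T) K)
    (hM : MonotoneOn K (Iic fun _ => T)) {c : ℝ} (hc : c ≤ T) {a : ℝ} (ha : 0 ≤ a)
    {α : Fin n → ℝ} (hα : 0 ≤ α) : recession K c (a • α) = a * recession K c α := by
  have hlim := (recession_spec hK hM hc (smul_nonneg ha hα)).2.2
  rcases ha.eq_or_lt with rfl | ha
  · rw [zero_mul]
    refine tendsto_nhds_unique hlim ?_
    have : Tendsto (fun s : ℝ => K (fun _ => c) * s⁻¹) atBot (𝓝 0) := by
      simpa using tendsto_inv_atBot_zero.const_mul (K (fun _ => c))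
    refine this.congr fun s => ?_
    simp [recessionQuotient, div_eq_mul_inv]
  · refine tendsto_nhds_unique hlim ?_
    have h1 : Tendsto (fun s : ℝ => a * s) atBot atBot := tendsto_id.const_mul_atBot ha
    have h2 := ((recession_spec hK hM hc hα).2.2.comp h1).const_mul a
    refine h2.congr' ?_
    filter_upwards [eventually_lt_atBot (0 : ℝ)] with s hs
    simp only [recessionQuotient, Function.comp, Pi.smul_apply, smul_eq_mul]
    have : (fun i => c + a * s * α i) = fun i => c + s * (a * α i) := by ext i; ring
    rw [this]
    field_simp

theorem recession_monotoneOn (hK : ConvexOn ℝ (Iic fun _ => T) K)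
    (hM : MonotoneOn K (Iic fun _ => T)) {c : ℝ} (hc : c ≤ T) :
    MonotoneOn (recession K c) (Ici 0) := by
  intro α hα β hβ hαβ
  refine le_of_tendsto_of_tendsto (recession_spec hK hM hc hα).2.2
    (recession_spec hK hM hc hβ).2.2 ?_
  filter_upwards [eventually_lt_atBot (0 : ℝ)] with s hs
  refine (div_le_div_right_of_neg hs).2 (hM (ray_mem hc hβ hs.le) (ray_mem hc hα hs.le) fun i => ?_)
  have := mul_le_mul_of_nonpos_left (hαβ i) hs.le
  simp only at this ⊢
  linarith [this]

theorem recession_concaveOn (hK : ConvexOn ℝ (Iic fun _ => T) K)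
    (hM : MonotoneOn K (Iic fun _ => T)) {c : ℝ} (hc : c ≤ T) :
    ConcaveOn ℝ (Ici 0) (recession K c) := by
  refine ⟨convex_Ici _, fun α hα β hβ a b ha hb hab => ?_⟩
  refine le_of_tendsto_of_tendsto
    (((recession_spec hK hM hc hα).2.2.const_mul a).add
      ((recession_spec hK hM hc hβ).2.2.const_mul b))
    (recession_spec hK hM hc (convex_Ici (𝕜 := ℝ) (0 : Fin n → ℝ) hα hβ ha hb hab)).2.2 ?_
  filter_upwards [eventually_lt_atBot (0 : ℝ)] with s hs
  have := hK.2 (ray_mem hc hα hs.le) (ray_mem hc hβ hs.le) ha hb hab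
  have e : a • (fun i => c + s * α i) + b • (fun i => c + s * β i)
      = fun i => c + s * (a • α + b • β) i := by
    ext i
    simp only [smul_eq_mul, Pi.add_apply, Pi.smul_apply]
    linear_combination c * hab
  rw [e] at this
  simp only [recessionQuotient]
  rw [← mul_div_assoc, ← mul_div_assoc, ← add_div]
  exact (div_le_div_right_of_neg hs).2 this

/-- One inequality is monotonicity. For the other, the ray from the diagonal point c' is a convex
combination of the ray from c, run at a different speed, and the fixed corner T, whose contribution
vanishes after division by s. -/
theorem recession_eq_of_lt (hK : ConvexOn ℝ (Iic fun _ => T) K)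
    (hM : MonotoneOn K (Iic fun _ => T)) {c c' : ℝ} (hcc : c < c') (hc' : c' < T)
    {α : Fin n → ℝ} (hα : 0 ≤ α) : recession K c α = recession K c' α := by
  have hc : c ≤ T := (hcc.trans hc').le
  apply le_antisymm
  -- This r solves r c + (1 - r) T = c'; it is positive because c' < T.
  · set r : ℝ := (T - c') / (T - c) with hr
    have hTc : 0 < T - c := by linarith
    have hr0 : 0 < r := div_pos (by linarith) hTc
    have hr1 : r < 1 := (div_lt_one hTc).2 (by linarith)
    have hrc : r * (T - c) = T - c' := by rw [hr]; field_simp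
    have h1 : Tendsto (fun s : ℝ => r⁻¹ * s) atBot atBot :=
      tendsto_id.const_mul_atBot (inv_pos.2 hr0)
    have h2 := (recession_spec hK hM hc hα).2.2.comp h1
    have h3 : Tendsto (fun s : ℝ => ((1 - r) * K (fun _ => T)) * s⁻¹) atBot (𝓝 0) := by
      simpa using tendsto_inv_atBot_zero.const_mul ((1 - r) * K (fun _ => T))
    have h4 := h2.add h3
    rw [add_zero] at h4
    refine le_of_tendsto_of_tendsto h4 (recession_spec hK hM hc'.le hα).2.2 ?_
    filter_upwards [eventually_lt_atBot (0 : ℝ)] with s hs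
    have hs' : r⁻¹ * s ≤ 0 := mul_nonpos_of_nonneg_of_nonpos (inv_pos.2 hr0).le hs.le
    have := hK.2 (ray_mem hc hα hs') (mem_Iic.2 (le_refl fun _ : Fin n => T))
      hr0.le (sub_nonneg.2 hr1.le) (by ring)
    have e : r • (fun i => c + r⁻¹ * s * α i) + (1 - r) • (fun _ => T)
        = fun i => c' + s * α i := by
      ext i
      simp only [smul_eq_mul, Pi.add_apply, Pi.smul_apply]
      have : r * (c + r⁻¹ * s * α i) = r * c + s * α i := by field_simp
      rw [this]
      linear_combination (-1) * hrc
    rw [e] at this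
    simp only [recessionQuotient, Function.comp]
    have e2 : K (fun i => c + r⁻¹ * s * α i) / (r⁻¹ * s) + (1 - r) * K (fun _ => T) * s⁻¹
        = (r • K (fun i => c + r⁻¹ * s * α i) + (1 - r) • K (fun _ => T)) / s := by
      simp only [smul_eq_mul]
      field_simp
    rw [e2]
    exact (div_le_div_right_of_neg hs).2 this
  · refine recession_le_of_le hK hM hK hM hc hc'.le hα fun s hs => ?_
    exact hM (ray_mem hc hα hs) (ray_mem hc'.le hα hs) fun i => by simpa using hcc.le

theorem recession_eq (hK : ConvexOn ℝ (Iic fun _ => T) K)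
    (hM : MonotoneOn K (Iic fun _ => T)) {c c' : ℝ} (hc : c < T) (hc' : c' < T)
    {α : Fin n → ℝ} (hα : 0 ≤ α) : recession K c α = recession K c' α := by
  rcases lt_trichotomy c c' with h | rfl | h
  · exact recession_eq_of_lt hK hM h hc' hα
  · rfl
  · exact (recession_eq_of_lt hK hM h hc hα).symm

/-- Lower semicontinuity comes from homogeneity and monotonicity, and so holds up to the boundary of
the orthant. Upper semicontinuity holds because the recession function is an infimum of secant
slopes, each continuous in α since `K` is continuous in the interior of its domain; this uses c < T.
-/
theorem recession_continuousOn (hK : ConvexOn ℝ (Iic fun _ => T) K)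
    (hM : MonotoneOn K (Iic fun _ => T)) {c : ℝ} (hc : c < T) :
    ContinuousOn (recession K c) (Ici 0) := by
  intro α hα
  have hspec := fun β (hβ : β ∈ Ici (0 : Fin n → ℝ)) => recession_spec hK hM hc.le hβ
  have hα0 := (hspec α hα).1
  refine tendsto_order.2 ⟨fun b hb => ?_, fun b hb => ?_⟩
  · obtain ⟨r, hr0, hr1, hr⟩ : ∃ r : ℝ, 0 ≤ r ∧ r < 1 ∧ b < r * recession K c α := by
      have : Tendsto (fun r : ℝ => r * recession K c α) (𝓝[<] 1) (𝓝 (1 * recession K c α)) :=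
        (tendsto_id.mul_const _).mono_left nhdsWithin_le_nhds
      rw [one_mul] at this
      have h1 := this.eventually (lt_mem_nhds hb)
      have h2 : ∀ᶠ r : ℝ in 𝓝[<] 1, r < 1 := self_mem_nhdsWithin
      have h3 : ∀ᶠ r : ℝ in 𝓝[<] 1, 0 < r :=
        nhdsWithin_le_nhds (lt_mem_nhds (by norm_num : (0 : ℝ) < 1))
      obtain ⟨r, h1, h2, h3⟩ := (h1.and (h2.and h3)).exists
      exact ⟨r, h3.le, h2, h1⟩
    -- Where α_i = 0 the bound is just β_i ≥ 0; elsewhere r α_i < α_i leaves room.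
    have hev : ∀ᶠ β in 𝓝[Ici 0] α, ∀ i, r * α i ≤ β i := by
      refine eventually_all.2 fun i => ?_
      rcases (hα i).eq_or_lt with h | h
      · filter_upwards [self_mem_nhdsWithin] with β hβ
        have : α i = 0 := h.symm
        rw [this, mul_zero]
        exact hβ i
      · have h1 : r * α i < α i := by
          have : (0 : ℝ) < α i := h
          nlinarith
        have h2 : Tendsto (fun β : Fin n → ℝ => β i) (𝓝[Ici 0] α) (𝓝 (α i)) :=
          ((continuous_apply i).tendsto α).mono_left nhdsWithin_le_nhds
        filter_upwards [h2.eventually (lt_mem_nhds h1)] with β hβ using hβ.le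
    filter_upwards [hev, self_mem_nhdsWithin] with β h1 h2
    refine hr.trans_le ?_
    rw [← recession_smul hK hM hc.le hr0 hα]
    exact recession_monotoneOn hK hM hc.le (mem_Ici.2 (smul_nonneg hr0 hα)) h2 h1
  · have hlim : Tendsto (fun s => (K (fun i => c + s * α i) - K (fun _ => c)) / s) atBot
        (𝓝 (recession K c α)) := by
      have h3 : Tendsto (fun s : ℝ => K (fun _ => c) * s⁻¹) atBot (𝓝 0) := by
        simpa using tendsto_inv_atBot_zero.const_mul (K (fun _ => c))
      have h4 := (hspec α hα).2.2.sub h3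
      rw [sub_zero] at h4
      refine h4.congr fun s => ?_
      rw [recessionQuotient, sub_div, div_eq_mul_inv (K fun _ => c)]
    obtain ⟨s, hs, hs0⟩ := ((hlim.eventually (gt_mem_nhds hb)).and
      (eventually_lt_atBot (0 : ℝ))).exists
    have hint : (fun i => c + s * α i) ∈ interior (Iic fun _ : Fin n => T) := by
      refine mem_interior.2 ⟨{t | ∀ i, t i < T}, fun t ht i => (ht i).le, ?_, fun i => ?_⟩
      · simp only [ofPred_forall]
        exact isOpen_iInter_of_finite fun i => isOpen_lt (continuous_apply i) continuous_const
      · have := mul_nonpos_of_nonpos_of_nonneg hs0.le (hα i)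
        simp only at this ⊢
        linarith [this]
    have hcont : ContinuousAt K (fun i => c + s * α i) :=
      hK.continuousOn_interior.continuousAt (isOpen_interior.mem_nhds hint)
    have hc2 : Tendsto (fun β : Fin n → ℝ => (K (fun i => c + s * β i) - K (fun _ => c)) / s)
        (𝓝 α) (𝓝 ((K (fun i => c + s * α i) - K (fun _ => c)) / s)) := by
      refine Tendsto.div_const (Tendsto.sub_const ?_ _) _
      refine hcont.tendsto.comp (f := fun (β : Fin n → ℝ) i => c + s * β i) ?_
      exact Continuous.tendsto (by fun_prop) α
    filter_upwards [nhdsWithin_le_nhds (hc2.eventually (gt_mem_nhds hs)), self_mem_nhdsWithin]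
      with β h1 h2
    exact ((hspec β h2).2.1 s hs0).trans_lt h1

end ConvexAnalysis

/-! ### Circle means and the convexity of suprema over polydiscs. -/

section Subharmonic

/-- Monotonicity of the lower integral needs no measurability, so none is asked of `v`. -/
theorem circleMean_le {v : ℂ → EReal} {c : ℂ} {r : ℝ} {b : ℝ → ℝ} (hb : Continuous b)
    (h : ∀ θ, v (circleMap c r θ) ≤ b θ) :
    circleMean v c r ≤ (((2 * Real.pi)⁻¹ * ∫ θ in (0 : ℝ)..(2 * Real.pi), b θ : ℝ) : EReal) := by
  have hpi : (0 : ℝ) < 2 * Real.pi := by positivity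
  have hint : Integrable b (volume.restrict (Ioc (0 : ℝ) (2 * Real.pi))) :=
    (hb.integrableOn_Icc (a := 0) (b := 2 * Real.pi)).mono_set Ioc_subset_Icc_self
  have hP : ∫⁻ θ in Ioc (0 : ℝ) (2 * Real.pi), ENNReal.ofReal (b θ) ≠ ⊤ :=
    hint.lintegral_lt_top.ne
  have hN : ∫⁻ θ in Ioc (0 : ℝ) (2 * Real.pi), ENNReal.ofReal (-b θ) ≠ ⊤ :=
    hint.neg.lintegral_lt_top.ne
  have h1 : ∫⁻ θ in Ioc (0 : ℝ) (2 * Real.pi), (v (circleMap c r θ)).toENNReal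
      ≤ ∫⁻ θ in Ioc (0 : ℝ) (2 * Real.pi), ENNReal.ofReal (b θ) := by
    refine lintegral_mono fun θ => ?_
    simpa using EReal.toENNReal_le_toENNReal (h θ)
  have h2 : ∫⁻ θ in Ioc (0 : ℝ) (2 * Real.pi), ENNReal.ofReal (-b θ)
      ≤ ∫⁻ θ in Ioc (0 : ℝ) (2 * Real.pi), (-v (circleMap c r θ)).toENNReal := by
    refine lintegral_mono fun θ => ?_
    have := EReal.toENNReal_le_toENNReal (EReal.neg_le_neg_iff.2 (h θ))
    rwa [← EReal.coe_neg, EReal.toENNReal_of_ne_top (EReal.coe_ne_top _), EReal.toReal_coe] at this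
  rw [intervalIntegral.integral_of_le hpi.le,
    integral_eq_lintegral_pos_part_sub_lintegral_neg_part hint]
  have key : ∀ P : ENNReal, P ≠ ⊤ →
      (((ENNReal.ofReal (2 * Real.pi))⁻¹ * P : ENNReal) : EReal)
        = (((2 * Real.pi)⁻¹ * P.toReal : ℝ) : EReal) := by
    intro P hPt
    rw [← ENNReal.ofReal_toReal hPt, ENNReal.toReal_ofReal ENNReal.toReal_nonneg,
      ← ENNReal.ofReal_inv_of_pos hpi, ← ENNReal.ofReal_mul (by positivity),
      EReal.coe_ennreal_ofReal, max_eq_left (by positivity)]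
  rw [mul_sub, EReal.coe_sub, ← key _ hP, ← key _ hN]
  exact EReal.sub_le_sub (EReal.coe_ennreal_le_coe_ennreal_iff.2 (by gcongr))
    (EReal.coe_ennreal_le_coe_ennreal_iff.2 (by gcongr))

/-- The negative part has infinite integral over a set of positive measure, and in `EReal` anything
minus ⊤ is ⊥. -/
theorem circleMean_eq_bot {v : ℂ → EReal} {c : ℂ} {r : ℝ} {S : Set ℝ} (hS : IsOpen S)
    (hne : S.Nonempty) (hsub : S ⊆ Ioc (0 : ℝ) (2 * Real.pi))
    (h : ∀ θ ∈ S, v (circleMap c r θ) = ⊥) : circleMean v c r = ⊥ := by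
  have h1 : ∫⁻ θ in Ioc (0 : ℝ) (2 * Real.pi), (-v (circleMap c r θ)).toENNReal = ⊤ := by
    refine top_le_iff.1 ?_
    calc (⊤ : ENNReal) = ∫⁻ _ in S, (⊤ : ENNReal) := by
          rw [setLIntegral_const, ENNReal.top_mul (hS.measure_pos volume hne).ne']
      _ = ∫⁻ θ in S, (-v (circleMap c r θ)).toENNReal := by
          refine setLIntegral_congr_fun hS.measurableSet fun θ hθ => ?_
          simp [h θ hθ]
      _ ≤ _ := lintegral_mono_set hsub
  rw [circleMean, h1, ENNReal.mul_top (ENNReal.inv_ne_zero.2 ENNReal.ofReal_ne_top)]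
  simp [sub_eq_add_neg]

/-- The properties of a plurisubharmonic function on an open set `O` of `ℂⁿ` which enter into the
convexity theorem. The constant `-∞` is allowed. -/
structure IsPshOn {n : ℕ} (ψ : (Fin n → ℂ) → EReal) (O : Set (Fin n → ℂ)) : Prop where
  ne_top : ∀ w ∈ O, ψ w ≠ ⊤
  usc : UpperSemicontinuousOn ψ O
  le_mean : ∀ σ : ℂ → Fin n → ℂ, Differentiable ℂ σ → MapsTo σ (Metric.ball 0 1) O →
    ψ (σ 0) ≤ circleMean (ψ ∘ σ) 0 (1 / 2)

variable {n : ℕ} {ψ : (Fin n → ℂ) → EReal} {O : Set (Fin n → ℂ)}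

/-- The value -∞ spreads from a neighbourhood of w to y: on a complex line, the circle centred at y
through w has an arc where ψ = -∞, so its mean is -∞. -/
theorem IsPshOn.eq_bot_of_ball (hψ : IsPshOn ψ O) {a w y : Fin n → ℂ} {ρ : ℝ}
    (hball : Metric.ball a ρ ⊆ O) (hw : w ∈ Metric.ball a (ρ / 8)) (hy : y ∈ Metric.ball a (ρ / 8))
    (hbot : ∀ᶠ x in 𝓝 w, ψ x = ⊥) : ψ y = ⊥ := by
  obtain ⟨W, hW, hWo, hwW⟩ := eventually_nhds_iff.1 hbot
  -- Here σ(0) = y and σ(-1/2) = w; the sign places w at the angle π, inside (0, 2π). The unit disc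
  -- is mapped to within 5ρ/8 of a.
  set σ : ℂ → Fin n → ℂ := fun ζ => y - (2 * ζ) • (w - y) with hσ
  have hσd : Differentiable ℂ σ := by fun_prop
  have hmaps : MapsTo σ (Metric.ball 0 1) O := by
    intro ζ hζ
    apply hball
    rw [mem_ball_iff_norm] at hw hy ⊢
    rw [mem_ball_zero_iff] at hζ
    have e : σ ζ - a = (y - a) + (-(2 * ζ)) • ((w - a) - (y - a)) := by
      simp only [hσ, neg_smul]
      rw [show w - a - (y - a) = w - y by abel]
      abel
    have h1 : ‖(w - a) - (y - a)‖ ≤ ‖w - a‖ + ‖y - a‖ := norm_sub_le _ _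
    have h2 : ‖(-(2 * ζ)) • ((w - a) - (y - a))‖ ≤ 2 * (‖w - a‖ + ‖y - a‖) := by
      rw [norm_smul, norm_neg, norm_mul, RCLike.norm_ofNat]
      have := norm_nonneg ((w - a) - (y - a))
      have := norm_nonneg ζ
      nlinarith
    rw [e]
    have := norm_add_le (y - a) ((-(2 * ζ)) • ((w - a) - (y - a)))
    have := norm_nonneg (y - a)
    linarith
  have h0 := hψ.le_mean σ hσd hmaps
  have hcirc : Continuous fun θ : ℝ => σ (circleMap 0 (1 / 2) θ) :=
    hσd.continuous.comp (continuous_circleMap _ _)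
  have hmean : circleMean (ψ ∘ σ) 0 (1 / 2) = ⊥ := by
    refine circleMean_eq_bot (S := Ioo 0 (2 * Real.pi) ∩ (fun θ : ℝ => σ (circleMap 0 (1 / 2) θ)) ⁻¹' W)
      (isOpen_Ioo.inter (hWo.preimage hcirc)) ⟨Real.pi, ⟨Real.pi_pos, ?_⟩, ?_⟩ ?_ ?_
    · linarith [Real.pi_pos]
    · have : σ (circleMap 0 (1 / 2) Real.pi) = w := by
        simp [hσ, circleMap]
      rw [mem_preimage, this]
      exact hwW
    · exact inter_subset_left.trans Ioo_subset_Ioc_self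
    · rintro θ ⟨-, hθ⟩
      exact hW _ hθ
  rw [hmean] at h0
  have : σ 0 = y := by simp [hσ]
  rw [this] at h0
  exact le_bot_iff.1 h0

/-- The closed polydisc with centre `0` and polyradius `(e^{t₁}, …, e^{t_n})`. -/
def box (t : Fin n → ℝ) : Set (Fin n → ℂ) := {w | ∀ i, ‖w i‖ ≤ Real.exp (t i)}

theorem box_mono {t t' : Fin n → ℝ} (h : t ≤ t') : box t ⊆ box t' := fun _ hw i =>
  (hw i).trans (Real.exp_le_exp.2 (h i))

theorem box_subset_closedBall {R : ℝ} (hR : 0 < R) {t : Fin n → ℝ}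
    (ht : t ∈ Iic fun _ => Real.log R) : box t ⊆ Metric.closedBall 0 R := by
  intro w hw
  rw [mem_closedBall_zero_iff, pi_norm_le_iff_of_nonneg hR.le]
  exact fun i => (hw i).trans ((Real.le_log_iff_exp_le hR).1 (ht i))

/-- The term C r²/2 is the strict loss, for C < 0, which drives the maximum principle below. -/
theorem integral_quadratic_cos (A B C r x₀ : ℝ) :
    (2 * Real.pi)⁻¹ * ∫ θ in (0 : ℝ)..(2 * Real.pi),
      (A + B * (x₀ + r * Real.cos θ) + C * (x₀ + r * Real.cos θ) ^ 2)
      = A + B * x₀ + C * x₀ ^ 2 + C * r ^ 2 / 2 := by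
  have e : (fun θ : ℝ => A + B * (x₀ + r * Real.cos θ) + C * (x₀ + r * Real.cos θ) ^ 2)
      = fun θ => ((A + B * x₀ + C * x₀ ^ 2) + (B * r + 2 * C * x₀ * r) * Real.cos θ)
        + C * r ^ 2 * Real.cos θ ^ 2 := by
    ext θ; ring
  rw [e, intervalIntegral.integral_add (Continuous.intervalIntegrable (by fun_prop) _ _)
      (Continuous.intervalIntegrable (by fun_prop) _ _),
    intervalIntegral.integral_add (Continuous.intervalIntegrable (by fun_prop) _ _)
      (Continuous.intervalIntegrable (by fun_prop) _ _),
    intervalIntegral.integral_const_mul, intervalIntegral.integral_const_mul, integral_cos_sq,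
    integral_cos, intervalIntegral.integral_const]
  simp
  field_simp

/-- A maximum principle along the family of polydiscs joining two given ones, with a strictly
concave quadratic majorant. -/
theorem IsPshOn.le_of_strictConcave (hψ : IsPshOn ψ O) {R : ℝ} (hR : 0 < R)
    (hRO : Metric.closedBall 0 R ⊆ O) {t t' : Fin n → ℝ} (ht : t ∈ Iic fun _ => Real.log R)
    (ht' : t' ∈ Iic fun _ => Real.log R) {A B C : ℝ} (hC : C < 0)
    (h0 : ∀ w ∈ box t, ψ w ≤ (A : ℝ)) (h1 : ∀ w ∈ box t', ψ w ≤ ((A + B + C : ℝ) : EReal))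
    {x : ℝ} (hx : x ∈ Icc (0 : ℝ) 1) {w : Fin n → ℂ} (hw : w ∈ Metric.closedBall 0 1) :
    ψ (fun j => w j * Complex.exp (t j + x * (t' j - t j))) ≤
      ((A + B * x + C * x ^ 2 : ℝ) : EReal) := by
  obtain ⟨P, hP⟩ : ∃ P : (Fin n → ℂ) × ℝ → Fin n → ℂ,
      P = fun p j => p.1 j * Complex.exp (t j + p.2 * (t' j - t j)) := ⟨_, rfl⟩
  obtain ⟨q, hq⟩ : ∃ q : ℝ → ℝ, q = fun x => A + B * x + C * x ^ 2 := ⟨_, rfl⟩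
  set K : Set ((Fin n → ℂ) × ℝ) := Metric.closedBall 0 1 ×ˢ Icc (0 : ℝ) 1 with hKdef
  have hK : IsCompact K := (isCompact_closedBall _ _).prod isCompact_Icc
  have hnorm : ∀ (v : ℂ) (j : Fin n) (ζ : ℂ),
      ‖v * Complex.exp (t j + ζ * (t' j - t j))‖ = ‖v‖ * Real.exp (t j + ζ.re * (t' j - t j)) := by
    intro v j ζ
    rw [norm_mul, Complex.norm_exp]
    congr 2
    rw [← Complex.ofReal_sub, Complex.add_re, Complex.re_mul_ofReal, Complex.ofReal_re]
  have hle1 : ∀ v ∈ Metric.closedBall (0 : Fin n → ℂ) 1, ∀ j, ‖v j‖ ≤ 1 := fun v hv j =>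
    (norm_le_pi_norm v j).trans (mem_closedBall_zero_iff.1 hv)
  have hPO : MapsTo P K O := by
    rintro ⟨v, y⟩ ⟨hv, hy0, hy1⟩
    refine hRO (box_subset_closedBall hR (t := fun j => t j + y * (t' j - t j)) ?_ ?_)
    · intro j
      have h2 := ht j
      have h3 := ht' j
      simp only at h2 h3 hy0 hy1 ⊢
      nlinarith
    · intro j
      have := hnorm (v j) j y
      simp only [hP]
      rw [this, Complex.ofReal_re]
      exact mul_le_of_le_one_left (Real.exp_pos _).le (hle1 v hv j)
  have hPc : Continuous P := by rw [hP]; fun_prop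
  have hqc : Continuous q := by rw [hq]; fun_prop
  -- The excess of ψ over the quadratic is upper semicontinuous on a compact set, so it attains its
  -- maximum. At x = 0 or 1 the hypotheses on the two boxes apply; an interior maximum with finite
  -- value is ruled out by the mean value over a disc through it.
  obtain ⟨F, hF⟩ : ∃ F : (Fin n → ℂ) × ℝ → EReal,
      F = fun p => ψ (P p) + ((-q p.2 : ℝ) : EReal) := ⟨_, rfl⟩
  have hFusc : UpperSemicontinuousOn F K := by
    rw [hF]
    refine UpperSemicontinuousOn.add' (hψ.usc.comp hPc.continuousOn hPO) ?_ ?_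
    · have : Continuous fun p : (Fin n → ℂ) × ℝ => ((-q p.2 : ℝ) : EReal) :=
        continuous_coe_real_ereal.comp (by fun_prop)
      exact this.upperSemicontinuous.upperSemicontinuousOn K
    · intro p _
      exact EReal.continuousAt_add (Or.inr (EReal.coe_ne_bot _)) (Or.inr (EReal.coe_ne_top _))
  have hFle : ∀ p c, F p ≤ (c : ℝ) ↔ ψ (P p) ≤ ((c + q p.2 : ℝ) : EReal) := by
    intro p c
    simp only [hF]
    rw [EReal.coe_neg, ← sub_eq_add_neg, EReal.sub_le_iff_le_add (Or.inl (EReal.coe_ne_bot _))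
      (Or.inl (EReal.coe_ne_top _)), EReal.coe_add c (q p.2)]
  suffices h : ∀ p ∈ K, F p ≤ (0 : ℝ) by
    have := (hFle (w, x) 0).1 (h (w, x) ⟨hw, hx⟩)
    simpa [hP, hq] using this
  have hKne : K.Nonempty := ⟨(w, x), hw, hx⟩
  obtain ⟨⟨w₀, x₀⟩, hmem, hmax⟩ := hFusc.exists_isMaxOn hKne hK
  replace hmax : ∀ p ∈ K, F p ≤ F (w₀, x₀) := isMaxOn_iff.1 hmax
  suffices h : F (w₀, x₀) ≤ (0 : ℝ) from fun p hp => (hmax p hp).trans h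
  obtain ⟨hw₀, hx₀, hx₁⟩ := hmem
  rcases hx₀.eq_or_lt with rfl | hx₀
  · refine (hFle _ _).2 ((h0 _ fun j => ?_).trans (by simp [hq]))
    have := hnorm (w₀ j) j (0 : ℝ)
    simp only [hP]
    rw [this]
    simpa using mul_le_of_le_one_left (Real.exp_pos (t j)).le (hle1 w₀ hw₀ j)
  rcases hx₁.eq_or_lt with rfl | hx₁
  · refine (hFle _ _).2 ((h1 _ fun j => ?_).trans (by simp [hq]))
    have := hnorm (w₀ j) j (1 : ℝ)
    simp only [hP]
    rw [this]
    simpa using mul_le_of_le_one_left (Real.exp_pos (t' j)).le (hle1 w₀ hw₀ j)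
  by_contra hcon
  have hbot : ψ (P (w₀, x₀)) ≠ ⊥ := by
    intro hb
    apply hcon
    rw [hFle, hb]
    exact bot_le
  obtain ⟨a, ha⟩ : ∃ a : ℝ, ψ (P (w₀, x₀)) = a :=
    ⟨_, (EReal.coe_toReal (hψ.ne_top _ (hPO ⟨hw₀, hx₀.le, hx₁.le⟩)) hbot).symm⟩
  obtain ⟨r, hr0, hr1, hr2⟩ : ∃ r : ℝ, 0 < r ∧ r ≤ x₀ ∧ r ≤ 1 - x₀ :=
    ⟨min x₀ (1 - x₀), lt_min hx₀ (sub_pos.2 hx₁), min_le_left _ _, min_le_right _ _⟩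
  obtain ⟨σ, hσ⟩ : ∃ σ : ℂ → Fin n → ℂ,
      σ = fun ζ j => w₀ j * Complex.exp (t j + (x₀ + r * ζ) * (t' j - t j)) := ⟨_, rfl⟩
  have hσd : Differentiable ℂ σ := by rw [hσ]; fun_prop
  -- The imaginary part of ζ only rotates the coordinates of w₀, so the disc stays in the family of
  -- polydiscs and the maximality of F can be used along it.
  have hσP : ∀ ζ : ℂ, ‖ζ‖ ≤ 1 → ∃ v ∈ Metric.closedBall (0 : Fin n → ℂ) 1,
      x₀ + r * ζ.re ∈ Icc (0 : ℝ) 1 ∧ σ ζ = P (v, x₀ + r * ζ.re) := by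
    intro ζ hζ
    have hre := abs_le.1 ((Complex.abs_re_le_norm ζ).trans hζ)
    refine ⟨fun j => w₀ j * Complex.exp ((r * ζ.im * (t' j - t j) : ℝ) * Complex.I), ?_,
      ⟨by nlinarith, by nlinarith⟩, ?_⟩
    · rw [mem_closedBall_zero_iff, pi_norm_le_iff_of_nonneg zero_le_one]
      intro j
      rw [norm_mul, Complex.norm_exp_ofReal_mul_I, mul_one]
      exact hle1 w₀ hw₀ j
    · ext j
      simp only [hσ, hP]
      rw [mul_assoc, ← Complex.exp_add]
      congr 2
      conv_lhs => rw [← Complex.re_add_im ζ]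
      push_cast
      ring
  have hmaps : MapsTo σ (Metric.ball 0 1) O := by
    intro ζ hζ
    obtain ⟨v, hv, hy, e⟩ := hσP ζ (mem_ball_zero_iff.1 hζ).le
    rw [e]
    exact hPO ⟨hv, hy⟩
  have hmean := hψ.le_mean σ hσd hmaps
  have hσ0 : σ 0 = P (w₀, x₀) := by
    ext j
    simp [hσ, hP]
  rw [hσ0, ha] at hmean
  -- By maximality ψ ∘ σ is at most a + q(x) - q(x₀) on the circle of radius 1/2, where x = x₀ +
  -- (r/2) cos θ. The mean of this bound is a + C r²/8 < a.
  have hb := circleMean_le (v := ψ ∘ σ) (c := 0) (r := 1 / 2)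
    (b := fun θ => (a - q x₀ + A) + B * (x₀ + r / 2 * Real.cos θ)
      + C * (x₀ + r / 2 * Real.cos θ) ^ 2) (by fun_prop) (by
    intro θ
    have hn : ‖circleMap 0 (1 / 2) θ‖ ≤ 1 := by
      rw [norm_circleMap_zero]; norm_num [abs_of_pos]
    obtain ⟨v, hv, hy, e⟩ := hσP _ hn
    have h2 : F (v, x₀ + r * (circleMap 0 (1 / 2) θ).re) ≤ ((a - q x₀ : ℝ) : EReal) := by
      refine (hmax _ ⟨hv, hy⟩).trans ((hFle _ _).2 ?_)
      rw [ha, sub_add_cancel]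
    rw [hFle, ← e] at h2
    refine h2.trans (EReal.coe_le_coe_iff.2 (le_of_eq ?_))
    have h3 : (circleMap 0 (1 / 2) θ).re = 1 / 2 * Real.cos θ := by
      rw [circleMap_zero, Complex.re_ofReal_mul, Complex.exp_ofReal_mul_I_re]
    rw [h3]
    simp only [hq]
    ring)
  rw [integral_quadratic_cos] at hb
  have h4 := EReal.coe_le_coe_iff.1 (hmean.trans hb)
  simp only [hq] at h4
  have : 0 < r ^ 2 := by positivity
  nlinarith

theorem IsPshOn.le_of_convexCombination (hψ : IsPshOn ψ O) {R : ℝ} (hR : 0 < R)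
    (hRO : Metric.closedBall 0 R ⊆ O) {t t' : Fin n → ℝ} (ht : t ∈ Iic fun _ => Real.log R)
    (ht' : t' ∈ Iic fun _ => Real.log R) {A B : ℝ}
    (h0 : ∀ w ∈ box t, ψ w ≤ (A : ℝ)) (h1 : ∀ w ∈ box t', ψ w ≤ (B : ℝ))
    {a b : ℝ} (ha : 0 ≤ a) (hb : 0 ≤ b) (hab : a + b = 1) {w : Fin n → ℂ}
    (hw : w ∈ box (a • t + b • t')) : ψ w ≤ ((a * A + b * B : ℝ) : EReal) := by
  refine EReal.le_of_forall_lt_iff_le.1 fun z hz => ?_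
  set δ : ℝ := z - (a * A + b * B) with hδ
  have hδ0 : 0 < δ := sub_pos.2 (EReal.coe_lt_coe_iff.1 hz)
  -- The quadratic takes the values A + δ at 0 and B at 1, and exceeds the chord from A to B at b by
  -- δ(1 - b²) ≤ δ.
  have key := hψ.le_of_strictConcave hR hRO ht ht' (A := A + δ) (B := B - A) (C := -δ)
    (neg_neg_of_pos hδ0) (fun v hv => (h0 v hv).trans (EReal.coe_le_coe_iff.2 (by linarith)))
    (fun v hv => (h1 v hv).trans (EReal.coe_le_coe_iff.2 (by linarith)))
    (x := b) ⟨hb, by linarith⟩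
    (w := fun j => w j * Complex.exp (-(t j + b * (t' j - t j) : ℝ))) (by
      rw [mem_closedBall_zero_iff, pi_norm_le_iff_of_nonneg zero_le_one]
      intro j
      have := hw j
      rw [norm_mul, Complex.norm_exp, ← Complex.ofReal_neg, Complex.ofReal_re, Real.exp_neg,
        ← div_eq_mul_inv, div_le_one (Real.exp_pos _)]
      refine this.trans (le_of_eq ?_)
      congr 1
      simp only [Pi.add_apply, Pi.smul_apply, smul_eq_mul]
      linear_combination (t j) * hab)
  have e : (fun j => w j * Complex.exp (-(t j + b * (t' j - t j) : ℝ))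
      * Complex.exp (t j + b * (t' j - t j))) = w := by
    ext j
    rw [mul_assoc, ← Complex.exp_add]
    simp
  rw [e] at key
  refine key.trans (EReal.coe_le_coe_iff.2 ?_)
  have : a = 1 - b := by linarith
  subst this
  nlinarith [sq_nonneg b]

/-- The supremum of `ψ` over the closed polydisc `box t`. -/
def boxSup (ψ : (Fin n → ℂ) → EReal) (t : Fin n → ℝ) : EReal := ⨆ w ∈ box t, ψ w

theorem boxSup_mono {t t' : Fin n → ℝ} (h : t ≤ t') : boxSup ψ t ≤ boxSup ψ t' :=
  biSup_mono (box_mono h)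

theorem IsPshOn.boxSup_ne_top (hψ : IsPshOn ψ O) {R : ℝ} (hR : 0 < R)
    (hRO : Metric.closedBall 0 R ⊆ O) {t : Fin n → ℝ} (ht : t ∈ Iic fun _ => Real.log R) :
    boxSup ψ t ≠ ⊤ := by
  obtain ⟨a, ha, hmax⟩ := (hψ.usc.mono hRO).exists_isMaxOn
    ⟨0, Metric.mem_closedBall_self hR.le⟩ (isCompact_closedBall 0 R)
  have : boxSup ψ t ≤ ψ a := iSup₂_le fun w hw => hmax (box_subset_closedBall hR ht hw)
  exact (this.trans_lt (lt_top_iff_ne_top.2 (hψ.ne_top a (hRO ha)))).ne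

theorem IsPshOn.boxSup_monotoneOn (hψ : IsPshOn ψ O) {R : ℝ} (hR : 0 < R)
    (hRO : Metric.closedBall 0 R ⊆ O)
    (hbot : ∀ t ∈ Iic (fun _ : Fin n => Real.log R), boxSup ψ t ≠ ⊥) :
    MonotoneOn (fun t => (boxSup ψ t).toReal) (Iic fun _ => Real.log R) := fun t ht _ ht' h =>
  EReal.toReal_le_toReal (boxSup_mono h) (hbot t ht) (hψ.boxSup_ne_top hR hRO ht')

theorem IsPshOn.boxSup_convexOn (hψ : IsPshOn ψ O) {R : ℝ} (hR : 0 < R)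
    (hRO : Metric.closedBall 0 R ⊆ O)
    (hbot : ∀ t ∈ Iic (fun _ : Fin n => Real.log R), boxSup ψ t ≠ ⊥) :
    ConvexOn ℝ (Iic fun _ => Real.log R) (fun t => (boxSup ψ t).toReal) := by
  have hle : ∀ t ∈ Iic (fun _ : Fin n => Real.log R), ∀ w ∈ box t,
      ψ w ≤ ((boxSup ψ t).toReal : EReal) := by
    intro t ht w hw
    rw [EReal.coe_toReal (hψ.boxSup_ne_top hR hRO ht) (hbot t ht)]
    exact le_iSup₂ (f := fun w (_ : w ∈ box t) => ψ w) w hw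
  refine ⟨convex_Iic _, fun t ht t' ht' a b ha hb hab => ?_⟩
  have hmem := convex_Iic (𝕜 := ℝ) (fun _ : Fin n => Real.log R) ht ht' ha hb hab
  have : boxSup ψ (a • t + b • t') ≤
      ((a * (boxSup ψ t).toReal + b * (boxSup ψ t').toReal : ℝ) : EReal) :=
    iSup₂_le fun w hw =>
      hψ.le_of_convexCombination hR hRO ht ht' (hle t ht) (hle t' ht') ha hb hab hw
  have h2 := EReal.toReal_le_toReal this (hbot _ hmem) (EReal.coe_ne_top _)
  rwa [EReal.toReal_coe] at h2

end Subharmonic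

/-! ### Polydiscs read in coordinates. -/

section Coordinates

variable {n : ℕ} {Ω : Type*} [TopologicalSpace Ω] {φ : Ω → EReal} {U : Set Ω}
  {u : OpenPartialHomeomorph Ω (Fin n → ℂ)}

/-- The part of the range of the coordinates `u` which corresponds to points of `U`. -/
def coordDomain (U : Set Ω) (u : OpenPartialHomeomorph Ω (Fin n → ℂ)) : Set (Fin n → ℂ) :=
  u.target ∩ u.symm ⁻¹' U

theorem isOpen_coordDomain (hU : IsOpen U) : IsOpen (coordDomain U u) :=
  u.isOpen_inter_preimage_symm hU

theorem supPolydisc_eq_boxSup {t : Fin n → ℝ} (ht : box t ⊆ u.target) :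
    supPolydisc φ u t = boxSup (φ ∘ u.symm) t := by
  apply le_antisymm
  · refine iSup₂_le fun x hx => ?_
    have h1 : u x ∈ box t := hx.2
    have := le_iSup₂ (f := fun w (_ : w ∈ box t) => (φ ∘ u.symm) w) (u x) h1
    simpa [u.left_inv hx.1, boxSup] using this
  · refine iSup₂_le fun w hw => ?_
    have h1 : u.symm w ∈ polydisc u t :=
      ⟨u.map_target (ht hw), by rw [u.right_inv (ht hw)]; exact hw⟩
    exact le_iSup₂ (f := fun x (_ : x ∈ polydisc u t) => φ x) (u.symm w) h1

/-- The norm of `Fin n → ℂ` is the sup norm, so closed balls are polydiscs. -/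
theorem IsAdmissible.closedBall_subset {ε : ℝ} (hε : IsAdmissible U u ε) :
    Metric.closedBall 0 ε ⊆ coordDomain U u := by
  intro w hw
  have hw' : ∀ i, ‖w i‖ ≤ ε := fun i =>
    (norm_le_pi_norm w i).trans (mem_closedBall_zero_iff.1 hw)
  have h1 := hε.subset_target hw'
  refine ⟨h1, hε.subset_domain ⟨u.map_target h1, fun i => ?_⟩⟩
  rw [u.right_inv h1, Real.exp_log hε.pos]
  exact hw' i

theorem isAdmissible_of_closedBall_subset {ε : ℝ} (hε : 0 < ε)
    (h : Metric.closedBall 0 ε ⊆ coordDomain U u) : IsAdmissible U u ε where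
  pos := hε
  subset_target w hw :=
    (h (mem_closedBall_zero_iff.2 ((pi_norm_le_iff_of_nonneg hε.le).2 hw))).1
  subset_domain := by
    rintro x ⟨hx, hx'⟩
    simp only [Real.exp_log hε] at hx'
    have := (h (mem_closedBall_zero_iff.2 ((pi_norm_le_iff_of_nonneg hε.le).2 hx'))).2
    simpa [u.left_inv hx] using this

theorem IsAdmissible.mono {ε δ : ℝ} (hε : IsAdmissible U u ε) (hδ : 0 < δ) (h : δ ≤ ε) :
    IsAdmissible U u δ :=
  isAdmissible_of_closedBall_subset hδ
    ((Metric.closedBall_subset_closedBall h).trans hε.closedBall_subset)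

/-- The coordinates `u - a`. -/
def shift (u : OpenPartialHomeomorph Ω (Fin n → ℂ)) (a : Fin n → ℂ) :
    OpenPartialHomeomorph Ω (Fin n → ℂ) :=
  u.trans (Homeomorph.subRight a).toOpenPartialHomeomorph

theorem shift_apply (a : Fin n → ℂ) (x : Ω) : shift u a x = u x - a := rfl

theorem shift_source (a : Fin n → ℂ) : (shift u a).source = u.source := by
  simp [shift]

theorem mem_coordDomain_shift {a w : Fin n → ℂ} :
    w ∈ coordDomain U (shift u a) ↔ w + a ∈ coordDomain U u := by
  simp [coordDomain, shift]

end Coordinates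

/-! ### Convexity of `H` on the manifold, and independence of the radius. -/

section Charts

variable {n : ℕ} {Ω : Type*} [TopologicalSpace Ω] [ChartedSpace (Fin n → ℂ) Ω]
  {φ : Ω → EReal} {U : Set Ω} {u u' : OpenPartialHomeomorph Ω (Fin n → ℂ)}

theorem IsPsh.isPshOn (hφ : IsPsh (n := n) φ U)
    (hu : u ∈ IsManifold.maximalAtlas 𝓘(ℂ, Fin n → ℂ) ω Ω) :
    IsPshOn (φ ∘ u.symm) (coordDomain U u) where
  ne_top w hw := hφ.ne_top _ hw.2
  usc := hφ.usc.comp (u.continuousOn_symm.mono inter_subset_left) fun _ hw => hw.2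
  le_mean σ hσ hmaps := by
    have hτ : MDifferentiableOn 𝓘(ℂ, ℂ) 𝓘(ℂ, Fin n → ℂ) (u.symm ∘ σ) (Metric.ball (0 : ℂ) 1) :=
      ((contMDiffOn_symm_of_mem_maximalAtlas hu).mdifferentiableOn (by simp)).comp
        hσ.differentiableOn.mdifferentiableOn fun ζ hζ => (hmaps hζ).1
    rcases hφ.disc _ hτ fun ζ hζ => (hmaps hζ).2 with h | h
    · refine h.le_mean 0 (1 / 2) (by norm_num) ?_
      exact Metric.closedBall_subset_ball (by norm_num)
    -- On a disc where φ is identically -∞ the inequality is trivial.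
    · have : (φ ∘ u.symm) (σ 0) = ⊥ := h 0 (Metric.mem_ball_self one_pos)
      rw [this]
      exact bot_le

variable [IsManifold 𝓘(ℂ, Fin n → ℂ) ω Ω]

/-- A plurisubharmonic function is not identically `-∞` on any nonempty open set. -/
theorem IsPsh.exists_ne_bot (hU : IsOpen U) (hφ : IsPsh (n := n) φ U) {V : Set Ω} (hV : IsOpen V)
    {z : Ω} (hzU : z ∈ U) (hzV : z ∈ V) : ∃ y ∈ V, φ y ≠ ⊥ := by
  by_contra! hcon
  set S := interior {x | φ x = ⊥} with hS
  have hzS : z ∈ S := mem_interior.2 ⟨V, fun y hy => hcon y hy, hV, hzV⟩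
  -- The interior S of {φ = -∞} is relatively closed in U, by propagation inside a small ball of a
  -- chart. If S met a component of U it would contain all of it.
  have hcl : closure S ∩ U ⊆ S := by
    rintro x ⟨hx, hxU⟩
    set e := chartAt (Fin n → ℂ) x with he
    have hxe : x ∈ e.source := mem_chart_source _ x
    have hea : e ∈ IsManifold.maximalAtlas 𝓘(ℂ, Fin n → ℂ) ω Ω :=
      IsManifold.chart_mem_maximalAtlas x
    have hmem : e x ∈ coordDomain U e :=
      ⟨e.map_source hxe, by simpa [e.left_inv hxe] using hxU⟩
    obtain ⟨ρ, hρ, hball⟩ := Metric.isOpen_iff.1 (isOpen_coordDomain (u := e) hU) _ hmem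
    set N := e.source ∩ e ⁻¹' Metric.ball (e x) (ρ / 8) with hN
    have hNo : IsOpen N := e.isOpen_inter_preimage Metric.isOpen_ball
    have hxN : x ∈ N := ⟨hxe, Metric.mem_ball_self (by positivity)⟩
    obtain ⟨p, hpN, hpS⟩ := mem_closure_iff.1 hx N hNo hxN
    refine mem_interior.2 ⟨N, fun y hy => ?_, hNo, hxN⟩
    have hbot : ∀ᶠ w in 𝓝 (e p), (φ ∘ e.symm) w = ⊥ := by
      have h1 : ∀ᶠ y in 𝓝 (e.symm (e p)), φ y = ⊥ := by
        rw [e.left_inv hpN.1]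
        exact mem_interior_iff_mem_nhds.1 hpS
      exact (e.continuousAt_symm (e.map_source hpN.1)).eventually h1
    have := (hφ.isPshOn hea).eq_bot_of_ball hball hpN.2 hy.2 hbot
    simpa [e.left_inv hy.1] using this
  obtain ⟨y, hy, hne⟩ := hφ.ne_bot z hzU
  have hsub := isPreconnected_connectedComponentIn.subset_of_closure_inter_subset
    (s := connectedComponentIn U z) isOpen_interior ⟨z, mem_connectedComponentIn hzU, hzS⟩
    fun x hx => hcl ⟨hx.1, connectedComponentIn_subset _ _ hx.2⟩
  exact hne (interior_subset (s := {x | φ x = ⊥}) (hsub hy))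

/-- The logarithmic polyradii can be taken slightly beyond an admissible radius. -/
theorem IsAdmissible.exists_convexOn (hU : IsOpen U) (hφ : IsPsh (n := n) φ U)
    (hu : u ∈ IsManifold.maximalAtlas 𝓘(ℂ, Fin n → ℂ) ω Ω) {ε : ℝ} (hε : IsAdmissible U u ε) :
    ∃ T, Real.log ε < T ∧
      (∀ t ∈ Iic (fun _ : Fin n => T), supPolydisc φ u t ≠ ⊥ ∧ supPolydisc φ u t ≠ ⊤) ∧
      ConvexOn ℝ (Iic fun _ => T) (fun t => (supPolydisc φ u t).toReal) ∧
      MonotoneOn (fun t => (supPolydisc φ u t).toReal) (Iic fun _ => T) := by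
  -- Compactness of the closed polydisc gives room for a larger one in the open domain, whence the
  -- strict inequality log ε < T needed for continuity and for (ii).
  obtain ⟨δ, hδ, hsub⟩ := (isCompact_closedBall (0 : Fin n → ℂ) ε).exists_cthickening_subset_open
    (isOpen_coordDomain hU) hε.closedBall_subset
  rw [cthickening_closedBall hδ.le hε.pos.le] at hsub
  have hR : 0 < δ + ε := add_pos hδ hε.pos
  have hψ := hφ.isPshOn hu
  have heq : ∀ t ∈ Iic (fun _ : Fin n => Real.log (δ + ε)),
      supPolydisc φ u t = boxSup (φ ∘ u.symm) t := fun t ht =>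
    supPolydisc_eq_boxSup fun w hw => (hsub (box_subset_closedBall hR ht hw)).1
  have hbot : ∀ t ∈ Iic (fun _ : Fin n => Real.log (δ + ε)), boxSup (φ ∘ u.symm) t ≠ ⊥ := by
    intro t ht
    have h0 : (0 : Fin n → ℂ) ∈ coordDomain U u := hsub (Metric.mem_closedBall_self hR.le)
    have hopen : IsOpen {w : Fin n → ℂ | ∀ i, ‖w i‖ < Real.exp (t i)} := by
      simp only [ofPred_forall]
      exact isOpen_iInter_of_finite fun i =>
        isOpen_lt (continuous_apply i).norm continuous_const
    obtain ⟨y, hy, hne⟩ := hφ.exists_ne_bot hU (u.isOpen_inter_preimage hopen) h0.2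
      ⟨u.map_target h0.1, fun i => by rw [u.right_inv h0.1]; simpa using Real.exp_pos (t i)⟩
    rw [← heq t ht]
    intro hb
    have hmem : y ∈ polydisc u t := ⟨hy.1, fun i => (hy.2 i).le⟩
    have := le_iSup₂ (f := fun x (_ : x ∈ polydisc u t) => φ x) y hmem
    exact hne (le_bot_iff.1 (this.trans hb.le))
  refine ⟨Real.log (δ + ε), Real.log_lt_log hε.pos (by linarith), fun t ht => ?_, ?_, ?_⟩
  · rw [heq t ht]
    exact ⟨hbot t ht, hψ.boxSup_ne_top hR hsub ht⟩
  · exact (hψ.boxSup_convexOn hR hsub hbot).congr fun t ht => by simp only [heq t ht]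
  · exact (hψ.boxSup_monotoneOn hR hsub hbot).congr fun t ht => by simp only [heq t ht]

theorem h_eq_of_isAdmissible (hU : IsOpen U) (hφ : IsPsh (n := n) φ U)
    (hu : u ∈ IsManifold.maximalAtlas 𝓘(ℂ, Fin n → ℂ) ω Ω) {ε ε' : ℝ}
    (hε : IsAdmissible U u ε) (hε' : IsAdmissible U u ε') {α : Fin n → ℝ} (hα : 0 ≤ α) :
    h φ u ε α = h φ u ε' α := by
  wlog hle : ε ≤ ε' generalizing ε ε'
  · exact (this hε' hε (le_of_not_ge hle)).symm
  obtain ⟨T, hT, -, hK, hM⟩ := hε'.exists_convexOn hU hφ hu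
  -- By definition `h` is `recession` of the real-valued `H` with base point log ε.
  exact recession_eq hK hM ((Real.log_le_log hε.pos hle).trans_lt hT) hT hα

theorem h_le_of_polydisc_subset (hU : IsOpen U) (hφ : IsPsh (n := n) φ U)
    (hu : u ∈ IsManifold.maximalAtlas 𝓘(ℂ, Fin n → ℂ) ω Ω)
    (hu' : u' ∈ IsManifold.maximalAtlas 𝓘(ℂ, Fin n → ℂ) ω Ω) {ε ε' : ℝ}
    (hε : IsAdmissible U u ε) (hε' : IsAdmissible U u' ε') {α : Fin n → ℝ} (hα : 0 ≤ α)
    (hsub : ∀ s ≤ (0 : ℝ), polydisc u (fun i => Real.log ε + s * α i) ⊆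
      polydisc u' (fun i => Real.log ε' + s * α i)) :
    h φ u' ε' α ≤ h φ u ε α := by
  obtain ⟨T, hT, hfin, hK, hM⟩ := hε.exists_convexOn hU hφ hu
  obtain ⟨T', hT', hfin', hK', hM'⟩ := hε'.exists_convexOn hU hφ hu'
  refine recession_le_of_le hK hM hK' hM' hT.le hT'.le hα fun s hs => ?_
  exact EReal.toReal_le_toReal (biSup_mono (hsub s hs)) (hfin _ (ray_mem hT.le hα hs)).1
    (hfin' _ (ray_mem hT'.le hα hs)).2

theorem trans_mem_maximalAtlas (hu : u ∈ IsManifold.maximalAtlas 𝓘(ℂ, Fin n → ℂ) ω Ω)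
    {e : OpenPartialHomeomorph (Fin n → ℂ) (Fin n → ℂ)} (he : ContDiffOn ℂ ω e e.source)
    (he' : ContDiffOn ℂ ω e.symm e.target) :
    u.trans e ∈ IsManifold.maximalAtlas 𝓘(ℂ, Fin n → ℂ) ω Ω := by
  rw [IsManifold.mem_maximalAtlas_iff_contMDiffOn]
  constructor
  · rw [OpenPartialHomeomorph.coe_trans, OpenPartialHomeomorph.trans_source]
    exact he.contMDiffOn.comp ((contMDiffOn_of_mem_maximalAtlas hu).mono inter_subset_left)
      fun x hx => hx.2
  · rw [OpenPartialHomeomorph.coe_trans_symm, OpenPartialHomeomorph.trans_target]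
    exact (contMDiffOn_symm_of_mem_maximalAtlas hu).comp (he'.contMDiffOn.mono inter_subset_left)
      fun x hx => hx.2

end Charts

/-! ### Change of adapted coordinates and of base point. -/

section AdaptedCoordinates

variable {n m : ℕ} {hmn : m ≤ n} {Ω : Type*} [TopologicalSpace Ω] [ChartedSpace (Fin n → ℂ) Ω]
  {φ : Ω → EReal} {U Z : Set Ω} {D : Fin m → Set Ω}
  {z : Ω} {u u' : OpenPartialHomeomorph Ω (Fin n → ℂ)}

theorem IsAdaptedCoord.zero_mem_target (hu : IsAdaptedCoord hmn D z u) : 0 ∈ u.target := by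
  rw [← hu.map_eq_zero]; exact u.map_source hu.mem_source

theorem IsAdaptedCoord.symm_zero (hu : IsAdaptedCoord hmn D z u) : u.symm 0 = z := by
  rw [← hu.map_eq_zero]; exact u.left_inv hu.mem_source

theorem IsAdaptedCoord.exists_isAdmissible (hu : IsAdaptedCoord hmn D z u) (hU : IsOpen U)
    (hz : z ∈ U) : ∃ ε, IsAdmissible U u ε := by
  have h0 : (0 : Fin n → ℂ) ∈ coordDomain U u :=
    ⟨hu.zero_mem_target, by rw [mem_preimage, hu.symm_zero]; exact hz⟩
  obtain ⟨ε, hε, hsub⟩ :=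
    Metric.nhds_basis_closedBall.mem_iff.1 ((isOpen_coordDomain hU).mem_nhds h0)
  exact ⟨ε, isAdmissible_of_closedBall_subset hε hsub⟩

/-- Near `z` the first `m` coordinates of one adapted system are bounded by multiples of the
corresponding coordinates of any other. -/
theorem IsAdaptedCoord.exists_polydisc_subset (hu : IsAdaptedCoord hmn D z u)
    (hu' : IsAdaptedCoord hmn D z u') {ε ε' : ℝ} (hε : 0 < ε) (hε' : 0 < ε') :
    ∃ δ, 0 < δ ∧ δ ≤ ε ∧ ∀ α : Fin n → ℝ, 0 ≤ α → (∀ i : Fin n, m ≤ (i : ℕ) → α i = 0) →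
      ∀ s ≤ (0 : ℝ), polydisc u (fun i => Real.log δ + s * α i) ⊆
        polydisc u' (fun i => Real.log ε' + s * α i) := by
  set F : (Fin n → ℂ) → (Fin n → ℂ) := u' ∘ u.symm with hF
  have hF0 : F 0 = 0 := by simp [hF, hu.symm_zero, hu'.map_eq_zero]
  have hFd : ContDiffAt ℂ 1 F 0 := by
    have h1 : ContMDiffAt 𝓘(ℂ, Fin n → ℂ) 𝓘(ℂ, Fin n → ℂ) ω F 0 := by
      refine ContMDiffAt.comp (I' := 𝓘(ℂ, Fin n → ℂ)) 0 ?_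
        (contMDiffAt_symm_of_mem_maximalAtlas hu.mem_atlas hu.zero_mem_target)
      exact contMDiffAt_of_mem_maximalAtlas hu'.mem_atlas (by rw [hu.symm_zero]; exact hu'.mem_source)
    exact (contMDiffAt_iff_contDiffAt.1 h1).of_le (by simp)
  obtain ⟨K, N, hN, hlip⟩ := hFd.exists_lipschitzOnWith
  have hcont : Tendsto u.symm (𝓝 0) (𝓝 z) := by
    have := u.continuousAt_symm hu.zero_mem_target
    rwa [ContinuousAt, hu.symm_zero] at this
  have hev : ∀ᶠ w in 𝓝 (0 : Fin n → ℂ), w ∈ N ∧ w ∈ u.target ∧ u.symm w ∈ u'.source ∧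
      ∀ i : Fin m, (w (Fin.castLE hmn i) = 0 → F w (Fin.castLE hmn i) = 0) := by
    filter_upwards [hN, u.open_target.mem_nhds hu.zero_mem_target,
      hcont.eventually (u'.open_source.mem_nhds hu'.mem_source),
      hcont.eventually (eventually_all.2 hu.adapted),
      hcont.eventually (eventually_all.2 hu'.adapted)] with w hwN hwt hws h1 h2
    refine ⟨hwN, hwt, hws, fun i hw => (h2 i).1 ((h1 i).2 ?_)⟩
    rwa [u.right_inv hwt]
  obtain ⟨δ₀, hδ₀, hball⟩ := Metric.nhds_basis_closedBall.mem_iff.1 hev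
  have hK : (0 : ℝ) ≤ K := K.2
  -- Dividing by K + 1 rather than K allows K = 0.
  obtain ⟨δ, hδ, h1, h2, h3⟩ : ∃ δ : ℝ, 0 < δ ∧ δ ≤ ε ∧ δ ≤ δ₀ ∧ K * δ ≤ ε' := by
    refine ⟨min ε (min δ₀ (ε' / (K + 1))), by positivity, min_le_left _ _,
      (min_le_right _ _).trans (min_le_left _ _), ?_⟩
    have : min ε (min δ₀ (ε' / (K + 1))) ≤ ε' / (K + 1) :=
      (min_le_right _ _).trans (min_le_right _ _)
    calc (K : ℝ) * min ε (min δ₀ (ε' / (K + 1))) ≤ K * (ε' / (K + 1)) := by gcongr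
      _ ≤ (K + 1) * (ε' / (K + 1)) := by gcongr; linarith
      _ = ε' := by field_simp
  refine ⟨δ, hδ, h1, fun α hα hα0 s hs x hx => ?_⟩
  obtain ⟨hxs, hxn⟩ := hx
  set w := u x with hw
  have hxw : u.symm w = x := u.left_inv hxs
  simp only [Real.exp_add, Real.exp_log hδ] at hxn
  have hexp : ∀ i, Real.exp (s * α i) ≤ 1 := fun i =>
    Real.exp_le_one_iff.2 (mul_nonpos_of_nonpos_of_nonneg hs (hα i))
  have hwδ : ‖w‖ ≤ δ := (pi_norm_le_iff_of_nonneg hδ.le).2 fun i =>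
    (hxn i).trans (mul_le_of_le_one_right hδ.le (hexp i))
  obtain ⟨hwN, -, hwu', -⟩ := hball (mem_closedBall_zero_iff.2 (hwδ.trans h2))
  rw [hxw] at hwu'
  refine ⟨hwu', fun i => ?_⟩
  have hFw : u' x = F w := by simp [hF, hxw]
  rw [Real.exp_add, Real.exp_log hε', hFw]
  rcases lt_or_ge (i : ℕ) m with hi | hi
  -- Setting the i-th coordinate to zero moves the point into D_i, where F_i vanishes; the Lipschitz
  -- bound between w and w₀ then controls F_i(w) by |w_i| alone.
  · set w₀ := Function.update w i 0 with hw₀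
    have hw₀n : ‖w₀‖ ≤ δ := by
      refine (pi_norm_le_iff_of_nonneg hδ.le).2 fun j => ?_
      rcases eq_or_ne j i with rfl | hj
      · simp [hw₀, hδ.le]
      · rw [hw₀, Function.update_of_ne hj]
        exact (norm_le_pi_norm w j).trans hwδ
    obtain ⟨hw₀N, -, -, hz0⟩ := hball (mem_closedBall_zero_iff.2 (hw₀n.trans h2))
    have hFi : F w₀ i = 0 := hz0 ⟨i, hi⟩ (by simp [hw₀])
    have hd : ‖F w - F w₀‖ ≤ K * ‖w - w₀‖ := by
      simpa [dist_eq_norm] using hlip.dist_le_mul w hwN w₀ hw₀N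
    have hn : ‖w - w₀‖ ≤ ‖w i‖ := by
      refine (pi_norm_le_iff_of_nonneg (norm_nonneg _)).2 fun j => ?_
      rcases eq_or_ne j i with rfl | hj
      · simp [hw₀]
      · simp [hw₀, Function.update_of_ne hj]
    calc ‖F w i‖ = ‖(F w - F w₀) i‖ := by rw [Pi.sub_apply, hFi, sub_zero]
      _ ≤ K * ‖w - w₀‖ := (norm_le_pi_norm _ i).trans hd
      _ ≤ K * (δ * Real.exp (s * α i)) := by gcongr; exact hn.trans (hxn i)
      _ = K * δ * Real.exp (s * α i) := by ring
      _ ≤ ε' * Real.exp (s * α i) := by gcongr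
  -- For these indices α_i = 0, so the radius does not shrink with s and a uniform bound suffices.
  · have h0N : (0 : Fin n → ℂ) ∈ N := mem_of_mem_nhds hN
    have hd : ‖F w‖ ≤ K * ‖w‖ := by
      simpa [dist_eq_norm, hF0] using hlip.dist_le_mul w hwN 0 h0N
    rw [hα0 i hi, mul_zero, Real.exp_zero, mul_one]
    calc ‖F w i‖ ≤ K * ‖w‖ := (norm_le_pi_norm _ i).trans hd
      _ ≤ K * δ := by gcongr
      _ ≤ ε' := h3

variable [IsManifold 𝓘(ℂ, Fin n → ℂ) ω Ω]

theorem IsAdaptedCoord.h_eq (hU : IsOpen U) (hφ : IsPsh (n := n) φ U)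
    (hu : IsAdaptedCoord hmn D z u) (hu' : IsAdaptedCoord hmn D z u') {ε ε' : ℝ}
    (hε : IsAdmissible U u ε) (hε' : IsAdmissible U u' ε') {α : Fin n → ℝ} (hα : 0 ≤ α)
    (hα0 : ∀ i : Fin n, m ≤ (i : ℕ) → α i = 0) : h φ u ε α = h φ u' ε' α := by
  have key : ∀ {u u' : OpenPartialHomeomorph Ω (Fin n → ℂ)} {ε ε' : ℝ},
      IsAdaptedCoord hmn D z u → IsAdaptedCoord hmn D z u' → IsAdmissible U u ε →
      IsAdmissible U u' ε' → h φ u' ε' α ≤ h φ u ε α := by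
    intro u u' ε ε' hu hu' hε hε'
    obtain ⟨δ, hδ, hle, hsub⟩ := hu.exists_polydisc_subset hu' hε.pos hε'.pos
    have hδ' := hε.mono hδ hle
    rw [h_eq_of_isAdmissible hU hφ hu.mem_atlas hε hδ' hα]
    exact h_le_of_polydisc_subset hU hφ hu.mem_atlas hu'.mem_atlas hδ' hε' hα (hsub α hα hα0)
  exact le_antisymm (key hu' hu hε' hε) (key hu hu' hε hε')

theorem shift_mem_maximalAtlas (hu : u ∈ IsManifold.maximalAtlas 𝓘(ℂ, Fin n → ℂ) ω Ω)
    (a : Fin n → ℂ) : shift u a ∈ IsManifold.maximalAtlas 𝓘(ℂ, Fin n → ℂ) ω Ω :=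
  trans_mem_maximalAtlas hu (contDiff_id.sub contDiff_const).contDiffOn
    (contDiff_id.add contDiff_const).contDiffOn

theorem IsAdaptedCoord.eventually_h_eq (hU : IsOpen U) (hφ : IsPsh (n := n) φ U)
    (hu : IsAdaptedCoord hmn D z u) {ε : ℝ} (hε : IsAdmissible U u ε) :
    ∀ᶠ z' in 𝓝 z, (∀ i, z' ∈ D i) → ∀ u' : OpenPartialHomeomorph Ω (Fin n → ℂ),
      IsAdaptedCoord hmn D z' u' → ∀ ε', IsAdmissible U u' ε' → ∀ α : Fin n → ℝ, 0 ≤ α →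
      (∀ i : Fin n, m ≤ (i : ℕ) → α i = 0) → h φ u ε α = h φ u' ε' α := by
  have hcont : Tendsto (fun x => ‖u x‖) (𝓝 z) (𝓝 0) := by
    have := (u.continuousAt hu.mem_source).norm
    rwa [ContinuousAt, hu.map_eq_zero, norm_zero] at this
  filter_upwards [u.open_source.mem_nhds hu.mem_source,
    hcont.eventually (gt_mem_nhds (half_pos hε.pos)),
    eventually_eventually_nhds.2 (eventually_all.2 hu.adapted)] with z' hs hn had hD u' hu' ε' hε'
    α hα hα0
  have hz0 : ∀ i : Fin n, (i : ℕ) < m → u z' i = 0 := fun i hi =>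
    (had.self_of_nhds ⟨i, hi⟩).1 (hD ⟨i, hi⟩)
  have hzn : ∀ i, ‖u z' i‖ ≤ ‖u z'‖ := norm_le_pi_norm _
  -- Since z' lies in every D_i, the translation leaves the first m coordinates unchanged.
  have hv : IsAdaptedCoord hmn D z' (shift u (u z')) :=
    { mem_atlas := shift_mem_maximalAtlas hu.mem_atlas _
      mem_source := by rwa [shift_source]
      map_eq_zero := by rw [shift_apply, sub_self]
      adapted := fun i => by
        filter_upwards [had] with y hy
        rw [hy i, shift_apply, Pi.sub_apply, hz0 (Fin.castLE hmn i) i.2, sub_zero] }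
  -- The translation has norm below ε/2. Thus radius ε/2 about z' fits into radius ε about z, and
  -- radius ε/2 - ‖u z'‖ about z fits into radius ε/2 about z'.
  have hvε : IsAdmissible U (shift u (u z')) (ε / 2) := by
    refine isAdmissible_of_closedBall_subset (half_pos hε.pos) fun w hw => ?_
    rw [mem_coordDomain_shift]
    refine hε.closedBall_subset (mem_closedBall_zero_iff.2 ((norm_add_le _ _).trans ?_))
    have := mem_closedBall_zero_iff.1 hw
    linarith
  rw [← hv.h_eq hU hφ hu' hvε hε' hα hα0]
  apply le_antisymm
  · refine h_le_of_polydisc_subset hU hφ hv.mem_atlas hu.mem_atlas hvε hε hα ?_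
    rintro s hs' x ⟨hx, hxn⟩
    rw [shift_source] at hx
    refine ⟨hx, fun i => ?_⟩
    have := hxn i
    rw [Real.exp_add, Real.exp_log (half_pos hε.pos), shift_apply, Pi.sub_apply] at this
    rw [Real.exp_add, Real.exp_log hε.pos]
    have hexp := Real.exp_pos (s * α i)
    have := hε.pos
    rcases lt_or_ge (i : ℕ) m with hi | hi
    · rw [hz0 i hi, sub_zero] at *
      nlinarith
    · rw [hα0 i hi, mul_zero, Real.exp_zero] at *
      have h1 := norm_sub_norm_le (u x i) (u z' i)
      have := hzn i
      linarith
  · have hη : 0 < ε / 2 - ‖u z'‖ := sub_pos.2 hn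
    have hη' : IsAdmissible U u (ε / 2 - ‖u z'‖) := hε.mono hη (by
      have := norm_nonneg (u z'); have := hε.pos; linarith)
    rw [h_eq_of_isAdmissible hU hφ hu.mem_atlas hε hη' hα]
    refine h_le_of_polydisc_subset hU hφ hu.mem_atlas hv.mem_atlas hη' hvε hα ?_
    rintro s hs' x ⟨hx, hxn⟩
    refine ⟨by rwa [shift_source], fun i => ?_⟩
    have := hxn i
    rw [Real.exp_add, Real.exp_log hη] at this
    rw [Real.exp_add, Real.exp_log (half_pos hε.pos), shift_apply, Pi.sub_apply]
    have hexp := Real.exp_pos (s * α i)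
    have := norm_nonneg (u z')
    rcases lt_or_ge (i : ℕ) m with hi | hi
    · rw [hz0 i hi, sub_zero]
      nlinarith
    · rw [hα0 i hi, mul_zero, Real.exp_zero] at *
      have h1 := norm_sub_le (u x i) (u z' i)
      have := hzn i
      linarith

end AdaptedCoordinates

/-! ### Existence of adapted coordinates. -/

section Existence

theorem exists_linearIndependent_castLE {𝕜 V : Type*} [Field 𝕜] [AddCommGroup V] [Module 𝕜 V]
    [FiniteDimensional 𝕜 V] {n m : ℕ} (hmn : m ≤ n) (hn : Module.finrank 𝕜 V = n) {l : Fin m → V}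
    (hl : LinearIndependent 𝕜 l) :
    ∃ L : Fin n → V, LinearIndependent 𝕜 L ∧ ∀ i, L (Fin.castLE hmn i) = l i := by
  set b := Module.Basis.sumExtend hl with hb
  have := Module.Finite.finite_basis b
  have : Finite (Module.Basis.sumExtendIndex hl) := Finite.sum_right (Fin m)
  have hcard : Nat.card (Module.Basis.sumExtendIndex hl) = n - m := by
    have h1 := Module.finrank_eq_nat_card_basis b
    rw [Nat.card_sum, Nat.card_fin, hn] at h1
    omega
  set e : Fin m ⊕ Module.Basis.sumExtendIndex hl ≃ Fin n :=
    ((Equiv.refl _).sumCongr (Finite.equivFinOfCardEq hcard)).trans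
      (finSumFinEquiv.trans (finCongr (by omega))) with he
  refine ⟨b.reindex e, (b.reindex e).linearIndependent, fun i => ?_⟩
  have h1 : e.symm (Fin.castLE hmn i) = Sum.inl i := by
    rw [Equiv.symm_apply_eq]
    ext
    simp [he]
  rw [Module.Basis.reindex_apply, h1, hb]
  simp only [Module.Basis.sumExtend, Module.Basis.reindex_apply, Module.Basis.extend_apply_self]
  rfl

/-- n independent covectors span the dual space, so a vector killed by all of them is killed by
every coordinate projection. -/
theorem exists_continuousLinearEquiv_of_linearIndependent {n : ℕ}
    {L : Fin n → (Fin n → ℂ) →L[ℂ] ℂ} (hL : LinearIndependent ℂ L) :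
    ∃ A : (Fin n → ℂ) ≃L[ℂ] (Fin n → ℂ), (A : (Fin n → ℂ) →L[ℂ] (Fin n → ℂ)) =
      ContinuousLinearMap.pi L := by
  have hfin : Module.finrank ℂ ((Fin n → ℂ) →L[ℂ] ℂ) = n := by
    rw [← (LinearMap.toContinuousLinearMap (𝕜 := ℂ) (E := Fin n → ℂ) (F' := ℂ)).finrank_eq]
    simp
  have hspan := hL.span_eq_top_of_card_eq_finrank' (by simp [hfin])
  have hinj : Function.Injective (ContinuousLinearMap.pi L).toLinearMap := by
    rw [← LinearMap.ker_eq_bot, LinearMap.ker_eq_bot']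
    intro v hv
    have hle : Submodule.span ℂ (range L) ≤
        LinearMap.ker ((ContinuousLinearMap.apply ℂ ℂ v).toLinearMap) := by
      rw [Submodule.span_le]
      rintro _ ⟨j, rfl⟩
      exact congrFun hv j
    rw [hspan, top_le_iff] at hle
    ext i
    have : ContinuousLinearMap.proj (R := ℂ) (φ := fun _ : Fin n => ℂ) i ∈
        LinearMap.ker ((ContinuousLinearMap.apply ℂ ℂ v).toLinearMap) := by rw [hle]; trivial
    exact this
  refine ⟨(LinearEquiv.ofInjectiveEndo _ hinj).toContinuousLinearEquiv, ?_⟩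
  ext v
  rfl

variable {n m : ℕ} {Ω : Type*} [TopologicalSpace Ω] [ChartedSpace (Fin n → ℂ) Ω]
  [IsManifold 𝓘(ℂ, Fin n → ℂ) ω Ω] {Z : Set Ω} {D : Fin m → Set Ω}

theorem IsTransverseIntersection.exists_isAdaptedCoord (hmn : m ≤ n)
    (hD : IsTransverseIntersection (n := n) Z D) {z : Ω} (hz : z ∈ Z) :
    ∃ u : OpenPartialHomeomorph Ω (Fin n → ℂ), IsAdaptedCoord hmn D z u := by
  have hzD : ∀ i, z ∈ D i := by
    have := hz
    rw [hD.eq_iInter] at this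
    exact mem_iInter.1 this
  choose f hf using fun i => hD.smooth i z (hzD i)
  have hlin := hD.transverse z hz f hf
  set e := chartAt (Fin n → ℂ) z with he
  have hze : z ∈ e.source := mem_chart_source _ z
  have hea : e ∈ IsManifold.maximalAtlas 𝓘(ℂ, Fin n → ℂ) ω Ω := IsManifold.chart_mem_maximalAtlas z
  set a := e z with ha
  have hae : a ∈ e.target := e.map_source hze
  have hsymm : e.symm a = z := e.left_inv hze
  have hg : ∀ i, ContDiffAt ℂ ω (f i ∘ e.symm) a := by
    intro i
    rw [← contMDiffAt_iff_contDiffAt]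
    refine ContMDiffAt.comp (I' := 𝓘(ℂ, Fin n → ℂ)) a ?_
      (contMDiffAt_symm_of_mem_maximalAtlas hea hae)
    rw [hsymm]
    exact (hf i).holo
  have hderiv : ∀ i, (show (Fin n → ℂ) →L[ℂ] ℂ from
      mfderiv 𝓘(ℂ, Fin n → ℂ) 𝓘(ℂ, ℂ) (f i) z) = fderiv ℂ (f i ∘ e.symm) a := by
    intro i
    have : MDifferentiableAt 𝓘(ℂ, Fin n → ℂ) 𝓘(ℂ, ℂ) (f i) z :=
      (hf i).holo.mdifferentiableAt (by simp)
    simp only [mfderiv, this, writtenInExtChartAt, extChartAt, mfld_simps,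
      fderivWithin_univ]
    rfl
  have hfin : Module.finrank ℂ ((Fin n → ℂ) →L[ℂ] ℂ) = n := by
    rw [← (LinearMap.toContinuousLinearMap (𝕜 := ℂ) (E := Fin n → ℂ) (F' := ℂ)).finrank_eq]
    simp
  obtain ⟨L, hL, hLi⟩ := exists_linearIndependent_castLE hmn hfin hlin
  obtain ⟨A, hA⟩ := exists_continuousLinearEquiv_of_linearIndependent hL
  -- The defining functions fill the first m slots. The others are affine, with covectors completing
  -- the differentials to a basis, so the derivative at a is invertible.
  set G : (Fin n → ℂ) → (Fin n → ℂ) := fun w j =>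
    if hj : (j : ℕ) < m then (f ⟨j, hj⟩ ∘ e.symm) w else L j (w - a) with hG
  have hGc : ContDiffAt ℂ ω G a := by
    rw [contDiffAt_pi]
    intro j
    by_cases hj : (j : ℕ) < m
    · simp only [hG, hj, dif_pos]
      exact hg ⟨j, hj⟩
    · simp only [hG, hj, dif_neg, not_false_eq_true]
      exact (L j).contDiff.contDiffAt.comp a (contDiffAt_id.sub contDiffAt_const)
  have hGd : HasFDerivAt G (A : (Fin n → ℂ) →L[ℂ] (Fin n → ℂ)) a := by
    rw [hA, hasFDerivAt_pi]
    intro j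
    by_cases hj : (j : ℕ) < m
    · have h1 := ((hg ⟨j, hj⟩).differentiableAt (by simp)).hasFDerivAt
      have h2 : L j = fderiv ℂ (f ⟨j, hj⟩ ∘ e.symm) a := by
        rw [← hderiv, ← hLi]
        rfl
      simpa only [hG, hj, dif_pos, h2] using h1
    · simp only [hj, dif_neg, not_false_eq_true]
      exact (L j).hasFDerivAt.comp a ((hasFDerivAt_id a).sub_const a)
  set E₀ := hGc.toOpenPartialHomeomorph G hGd (by simp) with hE₀
  have haE₀ : a ∈ E₀.source := hGc.mem_toOpenPartialHomeomorph_source hGd (by simp)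
  -- The local inverse is restricted so that both directions are analytic throughout the domain.
  set E := E₀.restrContDiff ℂ ω (by simp) with hE
  have haE : a ∈ E.source := by
    refine ⟨haE₀, hGc, E₀.contDiffAt_symm (f₀' := A) (E₀.map_source haE₀) ?_ ?_⟩
    · rw [E₀.left_inv haE₀]
      exact hGd
    · rw [E₀.left_inv haE₀]
      exact hGc
  have hEG : ∀ w, E w = G w := fun w => rfl
  refine ⟨e.trans E, trans_mem_maximalAtlas hea (E₀.contDiffOn_restrContDiff_source ℂ _)
    (E₀.contDiffOn_restrContDiff_target ℂ _), ⟨hze, haE⟩, ?_, fun i => ?_⟩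
  · ext j
    rw [OpenPartialHomeomorph.coe_trans, Function.comp_apply, hEG]
    by_cases hj : (j : ℕ) < m
    · simp only [hG, hj, dif_pos, Function.comp_apply, Pi.zero_apply]
      rw [e.left_inv hze]
      exact (hf _).zero.self_of_nhds.1 (hzD _)
    · simp [hG, hj, ha]
  · filter_upwards [(hf i).zero, e.open_source.mem_nhds hze] with y hy hye
    rw [hy, OpenPartialHomeomorph.coe_trans, Function.comp_apply, hEG]
    simp [hG, e.left_inv hye]

end Existence

end Kiselman

end

/-! ### Constancy on connected sets and the Kiselman number. -/

theorem lemmaL102 {n m : ℕ} (hm : 1 ≤ m) (hmn : m ≤ n)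
    {Ω : Type*} [TopologicalSpace Ω] [T2Space Ω] [ChartedSpace (Fin n → ℂ) Ω]
    [IsManifold 𝓘(ℂ, Fin n → ℂ) ω Ω]
    (Z : Set Ω) (D : Fin m → Set Ω) (hD : Kiselman.IsTransverseIntersection (n := n) Z D)
    (U : Set Ω) (hU : IsOpen U) (φ : Ω → EReal) (hφ : Kiselman.IsPsh (n := n) φ U) :
    -- the function `h` is well defined: `H` is finite and the limit exists
    (∀ z ∈ Z, ∀ u : OpenPartialHomeomorph Ω (Fin n → ℂ), Kiselman.IsAdaptedCoord hmn D z u →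
      ∀ ε : ℝ, Kiselman.IsAdmissible U u ε →
        (∀ t : Fin n → ℝ, (∀ i, t i ≤ Real.log ε) →
          Kiselman.supPolydisc φ u t ≠ ⊥ ∧ Kiselman.supPolydisc φ u t ≠ ⊤) ∧
        (∀ α : Fin n → ℝ, 0 ≤ α →
          Tendsto (Kiselman.quotient φ u ε α) atBot (𝓝 (Kiselman.h φ u ε α)))) ∧
    -- (i) nonnegative, continuous, concave, 1-homogeneous, increasing
    (∀ z ∈ Z, ∀ u : OpenPartialHomeomorph Ω (Fin n → ℂ), Kiselman.IsAdaptedCoord hmn D z u →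
      ∀ ε : ℝ, Kiselman.IsAdmissible U u ε →
        (∀ α : Fin n → ℝ, 0 ≤ α → 0 ≤ Kiselman.h φ u ε α) ∧
        ContinuousOn (Kiselman.h φ u ε) (Ici (0 : Fin n → ℝ)) ∧
        ConcaveOn ℝ (Ici (0 : Fin n → ℝ)) (Kiselman.h φ u ε) ∧
        (∀ (c : ℝ) (α : Fin n → ℝ), 0 ≤ c → 0 ≤ α →
          Kiselman.h φ u ε (c • α) = c * Kiselman.h φ u ε α) ∧
        MonotoneOn (Kiselman.h φ u ε) (Ici (0 : Fin n → ℝ))) ∧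
    -- (ii) independence of `ε`
    (∀ z ∈ Z, ∀ u : OpenPartialHomeomorph Ω (Fin n → ℂ), Kiselman.IsAdaptedCoord hmn D z u →
      ∀ ε ε' : ℝ, Kiselman.IsAdmissible U u ε → Kiselman.IsAdmissible U u ε' →
        ∀ α : Fin n → ℝ, 0 ≤ α → Kiselman.h φ u ε α = Kiselman.h φ u ε' α) ∧
    -- (iii) independence of the coordinates
    (∀ z ∈ Z, ∀ u u' : OpenPartialHomeomorph Ω (Fin n → ℂ),
      Kiselman.IsAdaptedCoord hmn D z u → Kiselman.IsAdaptedCoord hmn D z u' →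
      ∀ ε ε' : ℝ, Kiselman.IsAdmissible U u ε → Kiselman.IsAdmissible U u' ε' →
        ∀ α : Fin n → ℝ, 0 ≤ α → (∀ i : Fin n, m ≤ (i : ℕ) → α i = 0) →
          Kiselman.h φ u ε α = Kiselman.h φ u' ε' α) ∧
    -- (iv) independence of the base point
    (∀ C : Set Ω, C ⊆ Z ∩ U → IsPreconnected C → ∀ z ∈ C, ∀ z' ∈ C,
      ∀ u u' : OpenPartialHomeomorph Ω (Fin n → ℂ),
      Kiselman.IsAdaptedCoord hmn D z u → Kiselman.IsAdaptedCoord hmn D z' u' →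
      ∀ ε ε' : ℝ, Kiselman.IsAdmissible U u ε → Kiselman.IsAdmissible U u' ε' →
        ∀ α : Fin n → ℝ, 0 ≤ α → (∀ i : Fin n, m ≤ (i : ℕ) → α i = 0) →
          Kiselman.h φ u ε α = Kiselman.h φ u' ε' α) ∧
    -- consequently the Kiselman number is well defined
    (∀ C : Set Ω, C ⊆ Z ∩ U → IsConnected C →
      ∀ α : Fin n → ℝ, (∀ i : Fin n, (i : ℕ) < m → 0 < α i) →
        (∀ i : Fin n, m ≤ (i : ℕ) → α i = 0) →
        ∃! τ : ℝ, 0 ≤ τ ∧ ∀ z ∈ C, ∀ u : OpenPartialHomeomorph Ω (Fin n → ℂ),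
          Kiselman.IsAdaptedCoord hmn D z u →
          ∀ ε : ℝ, Kiselman.IsAdmissible U u ε → Kiselman.h φ u ε α = τ) := by
  have pack : ∀ u : OpenPartialHomeomorph Ω (Fin n → ℂ),
      u ∈ IsManifold.maximalAtlas 𝓘(ℂ, Fin n → ℂ) ω Ω → ∀ ε, Kiselman.IsAdmissible U u ε → _ :=
    fun u hu ε hε => hε.exists_convexOn hU hφ hu
  have nonneg : ∀ z ∈ Z, ∀ u : OpenPartialHomeomorph Ω (Fin n → ℂ),
      Kiselman.IsAdaptedCoord hmn D z u → ∀ ε : ℝ, Kiselman.IsAdmissible U u ε →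
        ∀ α : Fin n → ℝ, 0 ≤ α → 0 ≤ Kiselman.h φ u ε α := by
    intro z _ u hu ε hε α hα
    obtain ⟨T, hT, -, hK, hM⟩ := pack u hu.mem_atlas ε hε
    exact (Kiselman.recession_spec hK hM hT.le hα).1
  have point : ∀ C : Set Ω, C ⊆ Z ∩ U → IsPreconnected C → ∀ z ∈ C, ∀ z' ∈ C,
      ∀ u u' : OpenPartialHomeomorph Ω (Fin n → ℂ),
      Kiselman.IsAdaptedCoord hmn D z u → Kiselman.IsAdaptedCoord hmn D z' u' →
      ∀ ε ε' : ℝ, Kiselman.IsAdmissible U u ε → Kiselman.IsAdmissible U u' ε' →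
        ∀ α : Fin n → ℝ, 0 ≤ α → (∀ i : Fin n, m ≤ (i : ℕ) → α i = 0) →
          Kiselman.h φ u ε α = Kiselman.h φ u' ε' α := by
    intro C hCZ hC z hz z' hz' u u' hu hu' ε ε' hε hε' α hα hα0
    -- Equality for all choices of coordinates and radii is a symmetric, transitive relation between
    -- points that holds locally, so it holds throughout a preconnected set.
    refine hC.induction₂ (fun x y => ∀ u u' : OpenPartialHomeomorph Ω (Fin n → ℂ),
      Kiselman.IsAdaptedCoord hmn D x u → Kiselman.IsAdaptedCoord hmn D y u' →
      ∀ ε ε' : ℝ, Kiselman.IsAdmissible U u ε → Kiselman.IsAdmissible U u' ε' →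
        Kiselman.h φ u ε α = Kiselman.h φ u' ε' α) ?_ ?_ ?_ hz hz' u u' hu hu' ε ε' hε hε'
    · intro x hx
      obtain ⟨v, hv⟩ := hD.exists_isAdaptedCoord hmn (hCZ hx).1
      obtain ⟨δ, hδ⟩ := hv.exists_isAdmissible hU (hCZ hx).2
      filter_upwards [nhdsWithin_le_nhds (hv.eventually_h_eq hU hφ hδ), self_mem_nhdsWithin]
        with y hy hyC u u' hu hu' ε ε' hε hε'
      have hyD : ∀ i, y ∈ D i := by
        have := (hCZ hyC).1
        rw [hD.eq_iInter] at this
        exact mem_iInter.1 this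
      rw [hu.h_eq hU hφ hv hε hδ hα hα0]
      exact hy hyD u' hu' ε' hε' α hα hα0
    · intro x y w _ hy _ hxy hyw u u' hu hu' ε ε' hε hε'
      -- Transitivity needs actual coordinates at the middle point; otherwise the relation could
      -- hold vacuously there.
      obtain ⟨v, hv⟩ := hD.exists_isAdaptedCoord hmn (hCZ hy).1
      obtain ⟨δ, hδ⟩ := hv.exists_isAdmissible hU (hCZ hy).2
      exact (hxy u v hu hv ε δ hε hδ).trans (hyw v u' hv hu' δ ε' hδ hε')
    · intro x y _ _ hxy u u' hu hu' ε ε' hε hε'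
      exact (hxy u' u hu' hu ε' ε hε' hε).symm
  refine ⟨?_, ?_, ?_, ?_, point, ?_⟩
  · intro z _ u hu ε hε
    obtain ⟨T, hT, hfin, hK, hM⟩ := pack u hu.mem_atlas ε hε
    exact ⟨fun t ht => hfin t fun i => (ht i).trans hT.le,
      fun α hα => (Kiselman.recession_spec hK hM hT.le hα).2.2⟩
  · intro z hz u hu ε hε
    obtain ⟨T, hT, -, hK, hM⟩ := pack u hu.mem_atlas ε hε
    exact ⟨nonneg z hz u hu ε hε, Kiselman.recession_continuousOn hK hM hT,
      Kiselman.recession_concaveOn hK hM hT.le,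
      fun c α hc hα => Kiselman.recession_smul hK hM hT.le hc hα,
      Kiselman.recession_monotoneOn hK hM hT.le⟩
  · intro z _ u hu ε ε' hε hε' α hα
    exact Kiselman.h_eq_of_isAdmissible hU hφ hu.mem_atlas hε hε' hα
  · intro z _ u u' hu hu' ε ε' hε hε' α hα hα0
    exact hu.h_eq hU hφ hu' hε hε' hα hα0
  · intro C hCZ hC α hpos hα0
    have hα : 0 ≤ α := fun i => by
      rcases lt_or_ge (i : ℕ) m with hi | hi
      · exact (hpos i hi).le
      · exact (hα0 i hi).ge
    obtain ⟨z, hz⟩ := hC.nonempty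
    -- One actual choice of coordinates and radius supplies τ and forces its uniqueness.
    obtain ⟨u, hu⟩ := hD.exists_isAdaptedCoord hmn (hCZ hz).1
    obtain ⟨ε, hε⟩ := hu.exists_isAdmissible hU (hCZ hz).2
    refine ⟨Kiselman.h φ u ε α, ⟨nonneg z (hCZ hz).1 u hu ε hε α hα,
      fun z' hz' u' hu' ε' hε' => ?_⟩, fun τ hτ => (hτ.2 z hz u hu ε hε).symm⟩
    exact point C hCZ hC.isPreconnected z' hz' z hz u' u hu' hu ε' ε hε' hε α hα hα0
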